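/- For an odd prime power $q$ and an integer $d\ge 3$ let $$C=C_q=\{x\in\mathbb F_q^d : x_1^2+\cdots+x_{d-2}^2=x_{d-1}x_d\}.$$ For $f:\mathbb F_q^d\to\mathbb C$ and $y\in C$ put $A_Cf(y)=\frac1{|C|}\sum_{x\in C}f(y-x)$; that is, $A_Cf=(f*\sigma)|_C$, where $\sigma$ is the normalized surface measure on $C$. For $1\le p<\infty$ put $$\|f\|_{L^p(\mathbb F_q^d,dx)}=\Big(\tfrac1{q^d}\sum_{x\in\mathbb F_q^d}|f(x)|^p\Big)^{1/p},\qquad \|g\|_{L^p(C,\sigma)}=\Big(\tfrac1{|C|}\sum_{x\in C}|g(x)|^p\Big)^{1/p},$$ and for $p=\infty$ let both norms be the maximum of the absolute values. **Theorem.** Let $d\ge 4$ be even. (1) If $d\ge 6$, there is a constant $K$, depending only on $d$, such that for every odd prime power $q$ and every $f:\mathbb F_q^d\to\mathbb C$ $$\|A_Cf\|_{L^{d-2}(C,\sigma)}\le K\,\|f\|_{L^{\frac d{d-1}}(\mathbb F_q^d,dx)}.$$ (2) There is a constant $K$, depending only on $d$, such that for every odd prime power $q$ and every $f:\mathbb F_q^d\to\mathbb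 C$ $$\|A_Cf\|_{L^{\frac{d^2-2d+2}{d-2}}(C,\sigma)}\le K\,\|f\|_{L^{\frac{d^2-2d+2}{d^2-3d+2}}(\mathbb F_q^d,dx)}.$$ (3) Let $d\ge 6$ and $1\le p,r\le\infty$. There is a constant $K$ such that $\|A_Cf\|_{L^r(C,\sigma)}\le K\|f\|_{L^p(\mathbb F_q^d,dx)}$ for all $f:\mathbb F_q^d\to\mathbb C$ and all odd prime powers $q$ for which $C_q$ contains a $d/2$-dimensional linear subspace of $\mathbb F_q^d$, if and only if $\left(\frac1p,\frac1r\right)$ lies in the convex hull of the points $$(0,0),\quad (0,1),\quad \Big(\frac{d-1}d,1\Big),\quad \Big(\frac{d-1}d,\frac1{d-2}\Big),\quad \Big(\frac{d^2-3d+2}{d^2-2d+2},\frac{d-2}{d^2-2d+2}\Big).$$ -/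

import Mathlib

open scoped ENNReal

universe u

namespace ConeAveraging

/-- The `L^p` norm, `0 < p ≤ ∞`, of a function on a finite nonempty set `X` in which every point
has mass `1 / |X|`. For `X = F_q^d` this is the norm of `L^p(F_q^d, dx)`; for `X` the cone it is
the norm of `L^p(C, σ)`. -/
noncomputable def normLp {X : Type*} [Fintype X] (p : ℝ≥0∞) (f : X → ℂ) : ℝ :=
  if p = ∞ then ((Finset.univ.sup fun x => ‖f x‖₊ : NNReal) : ℝ)
  else ((1 / (Fintype.card X : ℝ)) * ∑ x, ‖f x‖ ^ p.toReal) ^ (1 / p.toReal)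

section Cone

variable (F : Type*) [Field F] [Fintype F] (d : ℕ) (hd : 3 ≤ d)

open Classical in
/-- The cone `x₁² + ⋯ + x_{d-2}² = x_{d-1} x_d` in `F^d` (coordinates are numbered from `0`). -/
noncomputable def cone : Finset (Fin d → F) :=
  {x | ∑ i : Fin (d - 2), x (Fin.castLE (Nat.sub_le d 2) i) ^ 2 =
    x ⟨d - 2, by omega⟩ * x ⟨d - 1, by omega⟩}

/-- The restricted averaging operator `A_C f = (f ∗ σ)|_C`, where `σ` is the normalized surface
measure on the cone, so that `(f ∗ σ)(y)` is the mean of `f (y - x)` over `x ∈ C`. -/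
noncomputable def restrictedAverage (f : (Fin d → F) → ℂ) : cone F d hd → ℂ :=
  fun y => (1 / ((cone F d hd).card : ℂ)) * ∑ x ∈ cone F d hd, f (y.1 - x)

/-- The estimate `‖A_C f‖_{L^r(C, σ)} ≤ K ‖f‖_{L^p(F^d, dx)}` for all `f : F^d → ℂ`. -/
def AveragingEstimate (p r : ℝ≥0∞) (K : ℝ) : Prop :=
  ∀ f : (Fin d → F) → ℂ, normLp r (restrictedAverage F d hd f) ≤ K * normLp p f

/-- The cone contains a linear subspace of dimension `d / 2` (used for even `d`). -/
def ContainsHalfDimSubspace : Prop :=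
  ∃ H : Submodule F (Fin d → F),
    Module.finrank F H = d / 2 ∧ (H : Set (Fin d → F)) ⊆ (cone F d hd : Set (Fin d → F))

end Cone

end ConeAveraging

open ConeAveraging

namespace ConeAveraging

/-! Let Q be the form that cuts out C, V = F^d and N = |V| = q^d. Detecting Q(y - x) = 0 by additive
characters gives 1_{Q(y-x)=0} = 1/q + k(x, y), where k is 1/q times the sum of ψ(t Q(y - x)) over t
≠ 0. The 1/q part contributes a constant, controlled by the mean of |f| since |C| is comparable to
q^{d-1}. What remains is to bound k as a bilinear form on V × C.

The main input is a pair of Stein–Tomas type bounds (`bilinBound_centeredKernel_cone`): at the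
reciprocal exponents (1/2, 1/2 + 1/d) and (1/2 + 1/d, 1/2) the form k has norm at most a constant
times q^{(d-1)/2}. By T T* these reduce to Gram kernels, summed over V or over C, which are averages
of the sums over y of ψ(u Q(y) + t Q(y - x) + t' Q(y - x')), with u = 0 for V and u ranging over F
for C. If u + t + t' ≠ 0 this is a Gauss sum of size at most √N. If u + t + t' = 0 it has size at
most N, and it vanishes off the graph t x + t' x' = 0; such triples lose a factor q in number.
Interpolating the first kind between ℓ¹ × ℓ¹ and ℓ² × ℓ², and applying Schur's test to the second,
gives O(q^{d-1}) for both (`bilinBound_phaseKernel`).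

Interpolating once more with the trivial bound |k| ≤ 1 on ℓ¹ × ℓ¹, up to the point where the power
of q matches the normalization of the measures, gives the two nontrivial vertices. The rest of the
pentagon follows by Riesz–Thorin between them, Jensen's inequality along the ray to the origin, and
the nesting of L^r norms on a probability space.

For sharpness, a point mass, the indicator of C and the indicator of a d/2-dimensional subspace
inside C each bound a power of q by a multiple of K (`necessary_powers`). As q is unbounded, the
exponents are nonpositive, and these are the three nontrivial sides of the pentagon
(`mem_convexHull_pentagon_iff`). The primes p ≡ 1 mod 4 supply the fields, since -1 is then a
square. -/

/-- The `ℓ^{1/a}` norm with respect to counting measure. -/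
noncomputable def ellNorm {X : Type*} [Fintype X] (a : ℝ) (f : X → ℂ) : ℝ :=
  (∑ x, ‖f x‖ ^ (1 / a)) ^ a

/-- The bilinear form with kernel `k` is bounded by `M` on `ℓ^{1/a} × ℓ^{1/b}`. -/
def BilinBound {X Y : Type*} [Fintype X] [Fintype Y] (k : X → Y → ℂ) (a b M : ℝ) : Prop :=
  ∀ (f : X → ℂ) (g : Y → ℂ), ‖∑ x, ∑ y, k x y * f x * g y‖ ≤ M * ellNorm a f * ellNorm b g

/-! ### Counting-measure norms, indexed by reciprocal exponents -/

section EllNorm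

variable {X Y : Type*} [Fintype X] [Fintype Y]

lemma ellNorm_nonneg (a : ℝ) (f : X → ℂ) : 0 ≤ ellNorm a f := by
  unfold ellNorm; positivity

lemma ellNorm_congr {a : ℝ} {f g : X → ℂ} (h : ∀ x, ‖f x‖ = ‖g x‖) : ellNorm a f = ellNorm a g := by
  simp [ellNorm, h]

lemma ellNorm_one (f : X → ℂ) : ellNorm 1 f = ∑ x, ‖f x‖ := by simp [ellNorm]

lemma ellNorm_smul {a : ℝ} (ha : 0 < a) (c : ℂ) (f : X → ℂ) :
    ellNorm a (fun x => c * f x) = ‖c‖ * ellNorm a f := by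
  unfold ellNorm
  simp_rw [norm_mul, Real.mul_rpow (norm_nonneg _) (norm_nonneg _), ← Finset.mul_sum]
  rw [Real.mul_rpow (by positivity) (by positivity), ← Real.rpow_mul (norm_nonneg _),
    one_div_mul_cancel ha.ne', Real.rpow_one]

lemma eq_zero_of_ellNorm_eq_zero {a : ℝ} (ha : 0 < a) {f : X → ℂ} (h : ellNorm a f = 0) (x : X) :
    f x = 0 := by
  unfold ellNorm at h
  rw [Real.rpow_eq_zero (by positivity) ha.ne',
    Finset.sum_eq_zero_iff_of_nonneg (fun _ _ => by positivity)] at h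
  have := h x (Finset.mem_univ x)
  rwa [Real.rpow_eq_zero (norm_nonneg _) (by positivity), norm_eq_zero] at this

lemma ellNorm_rpow {a : ℝ} (ha : 0 < a) (f : X → ℂ) :
    ellNorm a f ^ (1 / a) = ∑ x, ‖f x‖ ^ (1 / a) := by
  unfold ellNorm
  rw [← Real.rpow_mul (by positivity), mul_one_div_cancel ha.ne', Real.rpow_one]

lemma ellNorm_half_sq (f : X → ℂ) : ellNorm (1 / 2) f ^ 2 = ∑ x, ‖f x‖ ^ 2 := by
  have := ellNorm_rpow (a := 1 / 2) (by norm_num) f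
  norm_num at this
  exact_mod_cast this

/-- Counting-measure norms decrease with the exponent. -/
lemma ellNorm_anti {a b : ℝ} (ha : 0 < a) (hab : a ≤ b) (f : X → ℂ) :
    ellNorm a f ≤ ellNorm b f := by
  have hb : 0 < b := ha.trans_le hab
  rcases (ellNorm_nonneg b f).eq_or_lt with h | h
  · have h0 := eq_zero_of_ellNorm_eq_zero hb h.symm
    rw [← h]
    simp [ellNorm, h0, Real.zero_rpow (inv_ne_zero ha.ne'), Real.zero_rpow ha.ne']
  · have hle : ∀ x, ‖f x‖ ≤ ellNorm b f := fun x => by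
      rw [← Real.rpow_le_rpow_iff (norm_nonneg _) h.le (one_div_pos.2 hb), ellNorm_rpow hb]
      exact Finset.single_le_sum (f := fun x => ‖f x‖ ^ (1 / b)) (fun _ _ => by positivity)
        (Finset.mem_univ x)
    rw [← Real.rpow_le_rpow_iff (ellNorm_nonneg _ _) h.le (one_div_pos.2 ha), ellNorm_rpow ha]
    calc ∑ x, ‖f x‖ ^ (1 / a) ≤ ∑ x, ellNorm b f ^ (1 / a - 1 / b) * ‖f x‖ ^ (1 / b) := by
          refine Finset.sum_le_sum fun x _ => ?_
          rcases (norm_nonneg (f x)).eq_or_lt with h0 | h0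
          · rw [← h0, Real.zero_rpow (by positivity), Real.zero_rpow (by positivity)]; simp
          · calc ‖f x‖ ^ (1 / a) = ‖f x‖ ^ (1 / a - 1 / b) * ‖f x‖ ^ (1 / b) := by
                  rw [← Real.rpow_add h0]; ring_nf
              _ ≤ _ := by
                  gcongr
                  · exact sub_nonneg.2 (one_div_le_one_div_of_le ha hab)
                  · exact hle x
      _ = ellNorm b f ^ (1 / a) := by
          rw [← Finset.mul_sum, ← ellNorm_rpow hb, ← Real.rpow_add h]; ring_nf

lemma norm_sum_mul_le_ellNorm_half (f g : X → ℂ) :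
    ‖∑ x, f x * g x‖ ≤ ellNorm (1 / 2) f * ellNorm (1 / 2) g := by
  refine (norm_sum_le _ _).trans ?_
  refine abs_le_of_sq_le_sq' ?_ (mul_nonneg (ellNorm_nonneg _ _) (ellNorm_nonneg _ _)) |>.2
  rw [mul_pow, ellNorm_half_sq, ellNorm_half_sq]
  simp_rw [norm_mul]
  exact Finset.sum_mul_sq_le_sq_mul_sq _ _ _

/-- `ℓ^p` duality. -/
lemma ellNorm_le_of_forall_dual {y M : ℝ} (hM : 0 ≤ M) (hy : 0 < y) (hy1 : y < 1) (h : X → ℂ)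
    (H : ∀ g : X → ℂ, ‖∑ x, h x * g x‖ ≤ M * ellNorm (1 - y) g) : ellNorm y h ≤ M := by
  set A := ∑ x, ‖h x‖ ^ (1 / y) with hA
  have hA0 : 0 ≤ A := by positivity
  have hy' : 1 < 1 / y := by rw [lt_div_iff₀ hy]; linarith
  -- The extremizer in Hölder's inequality: h g = |h|^{1/y}, and |g|^{1/(1-y)} is the same function.
  set g : X → ℂ := fun x => (starRingEnd ℂ (h x) / ‖h x‖) * ((‖h x‖ ^ (1 / y - 1) : ℝ) : ℂ) with hg
  have h1 : ∀ x, h x * g x = ((‖h x‖ ^ (1 / y) : ℝ) : ℂ) := fun x => by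
    rcases (norm_nonneg (h x)).eq_or_lt with h0 | h0
    · rw [← h0, Real.zero_rpow (by positivity)]
      rw [norm_eq_zero.1 h0.symm]; simp
    · have : h x * g x = (h x * starRingEnd ℂ (h x)) / ‖h x‖ * ((‖h x‖ ^ (1 / y - 1) : ℝ) : ℂ) := by
        simp only [hg]; ring
      rw [this, Complex.mul_conj, Complex.normSq_eq_norm_sq, Real.rpow_sub_one h0.ne']
      push_cast
      have : (‖h x‖ : ℂ) ≠ 0 := by exact_mod_cast h0.ne'
      field_simp
  have h2 : ∀ x, ‖g x‖ ^ (1 / (1 - y)) = ‖h x‖ ^ (1 / y) := fun x => by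
    rcases (norm_nonneg (h x)).eq_or_lt with h0 | h0
    · have : g x = 0 := by simp [hg, norm_eq_zero.1 h0.symm]
      rw [this, ← h0, norm_zero, Real.zero_rpow (by positivity), Real.zero_rpow]
      exact (one_div_pos.2 (by linarith)).ne'
    · have : ‖g x‖ = ‖h x‖ ^ (1 / y - 1) := by
        simp only [hg, norm_mul, norm_div, RCLike.norm_conj, Complex.norm_real, norm_norm]
        rw [div_self h0.ne', one_mul, Real.norm_of_nonneg (by positivity)]
      rw [this, ← Real.rpow_mul h0.le]
      congr 1
      have : 1 - y ≠ 0 := by linarith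
      field_simp
  have h3 := H g
  have h4 : ∑ x, h x * g x = (A : ℂ) := by simp_rw [h1, hA]; push_cast; rfl
  have h5 : ellNorm (1 - y) g = A ^ (1 - y) := by simp only [ellNorm, h2, hA]
  rw [h4, h5, Complex.norm_real, Real.norm_of_nonneg hA0] at h3
  change A ^ y ≤ M
  rcases hA0.eq_or_lt with h0 | h0
  · rwa [← h0, Real.zero_rpow hy.ne']
  · have : A ^ y * A ^ (1 - y) ≤ M * A ^ (1 - y) := by
      rw [← Real.rpow_add h0]; simpa using h3
    exact le_of_mul_le_mul_right this (by positivity)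

end EllNorm

/-! ### Riesz–Thorin by the three lines theorem -/

section Interpolation

variable {X Y : Type*}

/-- The analytic family through `f` used for interpolation. -/
noncomputable def interpFamily (a₀ a₁ a : ℝ) (f : X → ℂ) (z : ℂ) (x : X) : ℂ :=
  f x / ‖f x‖ * Complex.exp ((Real.log ‖f x‖ / a : ℝ) * ((1 - z) * a₀ + z * a₁))

lemma norm_interpFamily {a₀ a₁ a : ℝ} (f : X → ℂ) (z : ℂ) {x : X} (hx : f x ≠ 0) :
    ‖interpFamily a₀ a₁ a f z x‖ = ‖f x‖ ^ (((1 - z.re) * a₀ + z.re * a₁) / a) := by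
  have h0 : 0 < ‖f x‖ := norm_pos_iff.2 hx
  rw [interpFamily, norm_mul, norm_div, Complex.norm_real, norm_norm, div_self h0.ne', one_mul,
    Complex.norm_exp, Real.rpow_def_of_pos h0]
  congr 1
  rw [Complex.re_ofReal_mul]
  simp
  ring

lemma interpFamily_zero {a₀ a₁ a : ℝ} {f : X → ℂ} (z : ℂ) {x : X} (hx : f x = 0) :
    interpFamily a₀ a₁ a f z x = 0 := by simp [interpFamily, hx]

/-- The modulus of the family depends only on Re z, so the normalization of f carries over to the
norm prescribed on each vertical line; it is used on Re z = 0 and Re z = 1. -/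
lemma ellNorm_interpFamily [Fintype X] {a₀ a₁ a b : ℝ} (ha : 0 < a) (hb : 0 < b) {f : X → ℂ} {z : ℂ}
    (hz : (1 - z.re) * a₀ + z.re * a₁ = b) (hf : ellNorm a f = 1) :
    ellNorm b (interpFamily a₀ a₁ a f z) = 1 := by
  have h : ∀ x, ‖interpFamily a₀ a₁ a f z x‖ ^ (1 / b) = ‖f x‖ ^ (1 / a) := fun x => by
    by_cases hx : f x = 0
    · rw [interpFamily_zero z hx, hx, norm_zero, Real.zero_rpow (by positivity),
        Real.zero_rpow (by positivity)]
    · rw [norm_interpFamily f z hx, ← Real.rpow_mul (norm_nonneg _), hz]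
      congr 1; field_simp
  have h1 := ellNorm_rpow ha f
  rw [hf, Real.one_rpow] at h1
  simp only [ellNorm, h, ← h1, Real.one_rpow]

lemma interpFamily_self {a₀ a₁ a : ℝ} (ha : 0 < a) {f : X → ℂ} {θ : ℝ}
    (hθ : (1 - θ) * a₀ + θ * a₁ = a) (x : X) : interpFamily a₀ a₁ a f θ x = f x := by
  by_cases hx : f x = 0
  · rw [interpFamily_zero _ hx, hx]
  · have h0 : 0 < ‖f x‖ := norm_pos_iff.2 hx
    have h1 : ((1 - (θ : ℂ)) * a₀ + θ * a₁) = (a : ℂ) := by rw [← hθ]; push_cast; ring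
    rw [interpFamily, h1, ← Complex.ofReal_mul, div_mul_cancel₀ _ ha.ne', ← Complex.ofReal_exp,
      Real.exp_log h0, div_mul_cancel₀]
    exact_mod_cast h0.ne'

lemma norm_interpFamily_le [Fintype X] {a₀ a₁ a : ℝ} (ha₀ : 0 < a₀) (ha₁ : 0 < a₁) (ha : 0 < a) {f : X → ℂ}
    (hf : ellNorm a f = 1) {z : ℂ} (hz0 : 0 ≤ z.re) (hz1 : z.re ≤ 1) (x : X) :
    ‖interpFamily a₀ a₁ a f z x‖ ≤ 1 := by
  by_cases hx : f x = 0
  · rw [interpFamily_zero _ hx]; simp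
  · rw [norm_interpFamily f z hx]
    refine Real.rpow_le_one (norm_nonneg _) ?_ ?_
    · have h1 := ellNorm_rpow ha f
      rw [hf, Real.one_rpow] at h1
      have h2 : ‖f x‖ ^ (1 / a) ≤ 1 := by
        refine le_of_le_of_eq ?_ h1.symm
        exact Finset.single_le_sum (f := fun x => ‖f x‖ ^ (1 / a)) (fun _ _ => by positivity)
          (Finset.mem_univ x)
      by_contra h
      push Not at h
      exact absurd (Real.one_lt_rpow h (one_div_pos.2 ha)) (not_lt.2 h2)
    · have : 0 ≤ 1 - z.re := by linarith
      positivity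

lemma differentiable_interpFamily {a₀ a₁ a : ℝ} (f : X → ℂ) (x : X) :
    Differentiable ℂ fun z => interpFamily a₀ a₁ a f z x := by
  unfold interpFamily; fun_prop

/-- The Riesz–Thorin theorem for bilinear forms on finite sets. -/
theorem BilinBound.interpolate [Fintype X] [Fintype Y] {k : X → Y → ℂ} {a₀ b₀ M₀ a₁ b₁ M₁ θ : ℝ}
    (h₀ : BilinBound k a₀ b₀ M₀) (h₁ : BilinBound k a₁ b₁ M₁) (ha₀ : 0 < a₀) (hb₀ : 0 < b₀)
    (ha₁ : 0 < a₁) (hb₁ : 0 < b₁) (hθ0 : 0 ≤ θ) (hθ1 : θ ≤ 1) :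
    BilinBound k ((1 - θ) * a₀ + θ * a₁) ((1 - θ) * b₀ + θ * b₁) (M₀ ^ (1 - θ) * M₁ ^ θ) := by
  have hpos : ∀ {s t : ℝ}, 0 < s → 0 < t → 0 < (1 - θ) * s + θ * t := by
    intro s t hs ht
    have : 0 ≤ 1 - θ := by linarith
    rcases hθ0.eq_or_lt with h | h
    · simp [← h, hs]
    · positivity
  set a := (1 - θ) * a₀ + θ * a₁ with ha_def
  set b := (1 - θ) * b₀ + θ * b₁ with hb_def
  have ha : 0 < a := hpos ha₀ ha₁
  have hb : 0 < b := hpos hb₀ hb₁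
  have key : ∀ (f : X → ℂ) (g : Y → ℂ), ellNorm a f = 1 → ellNorm b g = 1 →
      ‖∑ x, ∑ y, k x y * f x * g y‖ ≤ M₀ ^ (1 - θ) * M₁ ^ θ := by
    intro f g hf hg
    let Φ : ℂ → ℂ := fun z =>
      ∑ x, ∑ y, k x y * interpFamily a₀ a₁ a f z x * interpFamily b₀ b₁ b g z y
    have hd : Differentiable ℂ Φ := by
      refine Differentiable.fun_sum fun x _ => Differentiable.fun_sum fun y _ => ?_
      exact ((differentiable_const _).mul (differentiable_interpFamily f x)).mul
        (differentiable_interpFamily g y)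
    have hbd : ∀ z : ℂ, 0 ≤ z.re → z.re ≤ 1 → ‖Φ z‖ ≤ ∑ x, ∑ y, ‖k x y‖ := by
      intro z hz0 hz1
      refine (norm_sum_le _ _).trans (Finset.sum_le_sum fun x _ => (norm_sum_le _ _).trans
        (Finset.sum_le_sum fun y _ => ?_))
      rw [norm_mul, norm_mul]
      have h1 := norm_interpFamily_le ha₀ ha₁ ha hf hz0 hz1 x
      have h2 := norm_interpFamily_le hb₀ hb₁ hb hg hz0 hz1 y
      calc _ ≤ ‖k x y‖ * 1 * 1 := by gcongr
        _ = _ := by ring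
    -- On the two boundary lines both families have norm one, so `h₀` and `h₁` bound Φ there by M₀
    -- and M₁; at z = θ the families return f and g.
    have h3 := Complex.HadamardThreeLines.norm_le_interp_of_mem_verticalClosedStrip₀₁' Φ
      (z := θ) (a := M₀) (b := M₁) (by
        simp [Complex.HadamardThreeLines.verticalClosedStrip, hθ0, hθ1]) hd.diffContOnCl
      ⟨_, by
        rintro _ ⟨z, hz, rfl⟩
        simp only [Complex.HadamardThreeLines.verticalClosedStrip, Set.mem_preimage,
          Set.mem_Icc] at hz
        exact hbd z hz.1 hz.2⟩
      (by
        intro z hz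
        have hz : z.re = 0 := by simpa using hz
        have := h₀ (interpFamily a₀ a₁ a f z) (interpFamily b₀ b₁ b g z)
        rwa [ellNorm_interpFamily ha ha₀ (by simp [hz]) hf,
          ellNorm_interpFamily hb hb₀ (by simp [hz]) hg, mul_one, mul_one] at this)
      (by
        intro z hz
        have hz : z.re = 1 := by simpa using hz
        have := h₁ (interpFamily a₀ a₁ a f z) (interpFamily b₀ b₁ b g z)
        rwa [ellNorm_interpFamily ha ha₁ (by simp [hz]) hf,
          ellNorm_interpFamily hb hb₁ (by simp [hz]) hg, mul_one, mul_one] at this)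
    have h4 : Φ θ = ∑ x, ∑ y, k x y * f x * g y := by
      simp only [Φ]
      refine Finset.sum_congr rfl fun x _ => Finset.sum_congr rfl fun y _ => ?_
      rw [interpFamily_self ha ha_def.symm, interpFamily_self hb hb_def.symm]
    rw [h4] at h3
    simpa using h3
  intro f g
  rcases (ellNorm_nonneg a f).eq_or_lt with hf | hf
  · have := eq_zero_of_ellNorm_eq_zero ha hf.symm
    simp [← hf, this]
  rcases (ellNorm_nonneg b g).eq_or_lt with hg | hg
  · have := eq_zero_of_ellNorm_eq_zero hb hg.symm
    simp [← hg, this]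
  -- The general case follows by homogeneity.
  have h1 := key (fun x => ((ellNorm a f)⁻¹ : ℝ) * f x) (fun y => ((ellNorm b g)⁻¹ : ℝ) * g y)
    (by rw [ellNorm_smul ha, Complex.norm_real, Real.norm_of_nonneg (by positivity),
      inv_mul_cancel₀ hf.ne'])
    (by rw [ellNorm_smul hb, Complex.norm_real, Real.norm_of_nonneg (by positivity),
      inv_mul_cancel₀ hg.ne'])
  have h2 : ∑ x, ∑ y, k x y * (((ellNorm a f)⁻¹ : ℝ) * f x) * (((ellNorm b g)⁻¹ : ℝ) * g y) =
      ((ellNorm a f * ellNorm b g : ℝ) : ℂ)⁻¹ * ∑ x, ∑ y, k x y * f x * g y := by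
    rw [Finset.mul_sum]
    refine Finset.sum_congr rfl fun x _ => ?_
    rw [Finset.mul_sum]
    refine Finset.sum_congr rfl fun y _ => ?_
    push_cast; rw [mul_inv]; ring
  rw [h2, norm_mul, norm_inv, Complex.norm_real, Real.norm_of_nonneg (by positivity),
    inv_mul_le_iff₀ (by positivity)] at h1
  linarith

end Interpolation

/-! ### Calculus of bilinear bounds: Schur's test and T T* -/

section Bilinear

variable {X Y : Type*} [Fintype X] [Fintype Y]

lemma BilinBound.mono {k : X → Y → ℂ} {a b M M' : ℝ} (h : BilinBound k a b M) (hM : M ≤ M') :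
    BilinBound k a b M' := fun f g => (h f g).trans (by
      have := ellNorm_nonneg a f
      have := ellNorm_nonneg b g
      gcongr)

lemma BilinBound.mono_exponent {k : X → Y → ℂ} {a b a' b' M : ℝ} (h : BilinBound k a b M)
    (hM : 0 ≤ M) (ha : 0 < a) (hb : 0 < b) (haa : a ≤ a') (hbb : b ≤ b') :
    BilinBound k a' b' M := fun f g => (h f g).trans (by
      have := ellNorm_anti ha haa f
      have := ellNorm_anti hb hbb g
      have := ellNorm_nonneg a' f
      have := ellNorm_nonneg b g
      gcongr)

lemma BilinBound.add {k k' : X → Y → ℂ} {a b M M' : ℝ} (h : BilinBound k a b M)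
    (h' : BilinBound k' a b M') : BilinBound (fun x y => k x y + k' x y) a b (M + M') := by
  intro f g
  simp_rw [add_mul, Finset.sum_add_distrib]
  exact (norm_add_le _ _).trans (by linarith [h f g, h' f g])

lemma BilinBound.const_mul {k : X → Y → ℂ} {a b M : ℝ} (c : ℂ) (h : BilinBound k a b M) :
    BilinBound (fun x y => c * k x y) a b (‖c‖ * M) := by
  intro f g
  have h1 : ∑ x, ∑ y, c * k x y * f x * g y = c * ∑ x, ∑ y, k x y * f x * g y := by
    simp_rw [Finset.mul_sum, mul_assoc]
  rw [h1, norm_mul, mul_assoc, mul_assoc, ← mul_assoc M]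
  exact mul_le_mul_of_nonneg_left (h f g) (norm_nonneg c)

lemma BilinBound.sum {ι : Type*} (s : Finset ι) {k : ι → X → Y → ℂ} {a b M : ℝ}
    (h : ∀ i ∈ s, BilinBound (k i) a b M) :
    BilinBound (fun x y => ∑ i ∈ s, k i x y) a b (s.card * M) := by
  classical
  induction s using Finset.induction_on with
  | empty => intro f g; simp
  | insert i s hi ih =>
    simp_rw [Finset.sum_insert hi, Finset.card_insert_of_notMem hi]
    refine ((h i (by simp)).add (ih fun j hj => h j (by simp [hj]))).mono ?_
    push_cast; linarith

lemma BilinBound.flip {k : X → Y → ℂ} {a b M : ℝ} (h : BilinBound k a b M) :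
    BilinBound (fun y x => k x y) b a M := by
  intro f g
  have := h g f
  rw [Finset.sum_comm]
  simp_rw [mul_right_comm _ (f _)]
  linarith

lemma bilinBound_one_one {k : X → Y → ℂ} {M : ℝ} (h : ∀ x y, ‖k x y‖ ≤ M) :
    BilinBound k 1 1 M := by
  intro f g
  rw [ellNorm_one, ellNorm_one, mul_assoc, Finset.sum_mul_sum, Finset.mul_sum]
  refine (norm_sum_le _ _).trans (Finset.sum_le_sum fun x _ => (norm_sum_le _ _).trans ?_)
  rw [Finset.mul_sum]
  refine Finset.sum_le_sum fun y _ => ?_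
  rw [norm_mul, norm_mul, mul_assoc]
  exact mul_le_mul_of_nonneg_right (h x y) (by positivity)

/-- Schur's test. -/
lemma bilinBound_half_half {k : X → Y → ℂ} {R : ℝ} (hR : 0 ≤ R) (h₁ : ∀ x, ∑ y, ‖k x y‖ ≤ R)
    (h₂ : ∀ y, ∑ x, ‖k x y‖ ≤ R) : BilinBound k (1 / 2) (1 / 2) R := by
  intro f g
  have h3 : ‖∑ x, ∑ y, k x y * f x * g y‖ ≤ ∑ p : X × Y, 
      (√‖k p.1 p.2‖ * ‖f p.1‖) * (√‖k p.1 p.2‖ * ‖g p.2‖) := by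
    rw [Fintype.sum_prod_type]
    refine (norm_sum_le _ _).trans (Finset.sum_le_sum fun x _ => (norm_sum_le _ _).trans
      (Finset.sum_le_sum fun y _ => le_of_eq ?_))
    rw [norm_mul, norm_mul]
    nth_rewrite 1 [← Real.mul_self_sqrt (norm_nonneg (k x y))]
    ring
  refine h3.trans (abs_le_of_sq_le_sq' ?_
    (mul_nonneg (mul_nonneg hR (ellNorm_nonneg _ _)) (ellNorm_nonneg _ _)) |>.2)
  refine (Finset.sum_mul_sq_le_sq_mul_sq _ _ _).trans ?_
  have h4 : ∑ p : X × Y, (√‖k p.1 p.2‖ * ‖f p.1‖) ^ 2 ≤ R * ∑ x, ‖f x‖ ^ 2 := by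
    rw [Fintype.sum_prod_type, Finset.mul_sum]
    refine Finset.sum_le_sum fun x _ => ?_
    simp_rw [mul_pow, Real.sq_sqrt (norm_nonneg _), ← Finset.sum_mul]
    exact mul_le_mul_of_nonneg_right (h₁ x) (by positivity)
  have h5 : ∑ p : X × Y, (√‖k p.1 p.2‖ * ‖g p.2‖) ^ 2 ≤ R * ∑ y, ‖g y‖ ^ 2 := by
    rw [Fintype.sum_prod_type_right, Finset.mul_sum]
    refine Finset.sum_le_sum fun y _ => ?_
    simp_rw [mul_pow, Real.sq_sqrt (norm_nonneg _), ← Finset.sum_mul]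
    exact mul_le_mul_of_nonneg_right (h₂ y) (by positivity)
  calc _ ≤ (R * ∑ x, ‖f x‖ ^ 2) * (R * ∑ y, ‖g y‖ ^ 2) := by gcongr
    _ = _ := by rw [mul_pow, mul_pow, ellNorm_half_sq, ellNorm_half_sq]; ring

/-- The kernel of `k* k` on the second variable. -/
noncomputable def gramKernel (k : X → Y → ℂ) (y y' : Y) : ℂ :=
  ∑ x, k x y * starRingEnd ℂ (k x y')

lemma sum_gramKernel (k : X → Y → ℂ) (g h : Y → ℂ) :
    ∑ y, ∑ y', gramKernel k y y' * g y * h y' =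
      ∑ x, (∑ y, k x y * g y) * (∑ y, starRingEnd ℂ (k x y) * h y) := by
  simp_rw [gramKernel, Finset.sum_mul_sum, Finset.sum_mul]
  rw [Finset.sum_comm]
  have : ∀ y' : Y, ∑ y, ∑ x, k x y * starRingEnd ℂ (k x y') * g y * h y' =
      ∑ x, ∑ y, k x y * starRingEnd ℂ (k x y') * g y * h y' := fun y' => Finset.sum_comm
  simp_rw [this]
  rw [Finset.sum_comm]
  refine Finset.sum_congr rfl fun x _ => ?_
  rw [Finset.sum_comm]
  exact Finset.sum_congr rfl fun y _ => Finset.sum_congr rfl fun y' _ => by ring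

/-- The `T T*` principle. -/
lemma BilinBound.of_gramKernel {k : X → Y → ℂ} {b M : ℝ} (hM : 0 ≤ M)
    (h : BilinBound (gramKernel k) b b (M ^ 2)) : BilinBound k (1 / 2) b M := by
  intro f g
  have h1 : ∑ x, ∑ y, k x y * f x * g y = ∑ x, f x * ∑ y, k x y * g y := by
    refine Finset.sum_congr rfl fun x _ => ?_
    rw [Finset.mul_sum]
    exact Finset.sum_congr rfl fun y _ => by ring
  rw [h1]
  refine (norm_sum_mul_le_ellNorm_half _ _).trans ?_
  have h2 : ellNorm (1 / 2) (fun x => ∑ y, k x y * g y) ≤ M * ellNorm b g := by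
    refine abs_le_of_sq_le_sq' ?_ (mul_nonneg hM (ellNorm_nonneg _ _)) |>.2
    rw [ellNorm_half_sq]
    have h3 := h g (fun y => starRingEnd ℂ (g y))
    rw [sum_gramKernel, ellNorm_congr (f := fun y => starRingEnd ℂ (g y)) (g := g)
      (fun y => RCLike.norm_conj _)] at h3
    have h4 : ∑ x, (∑ y, k x y * g y) * (∑ y, starRingEnd ℂ (k x y) * starRingEnd ℂ (g y)) =
        ((∑ x, ‖∑ y, k x y * g y‖ ^ 2 : ℝ) : ℂ) := by
      push_cast
      refine Finset.sum_congr rfl fun x _ => ?_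
      simp_rw [← map_mul, ← map_sum]
      rw [Complex.mul_conj, Complex.normSq_eq_norm_sq]
      push_cast; rfl
    rw [h4, Complex.norm_real, Real.norm_of_nonneg (by positivity)] at h3
    calc _ ≤ _ := h3
      _ = _ := by ring
  calc _ ≤ ellNorm (1 / 2) f * (M * ellNorm b g) :=
        mul_le_mul_of_nonneg_left h2 (ellNorm_nonneg _ _)
    _ = _ := by ring

lemma BilinBound.ellNorm_half_le {k : X → Y → ℂ} {b M : ℝ} (hM : 0 ≤ M)
    (h : BilinBound k (1 / 2) b M) (g : Y → ℂ) :
    ellNorm (1 / 2) (fun x => ∑ y, k x y * g y) ≤ M * ellNorm b g := by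
  refine ellNorm_le_of_forall_dual (mul_nonneg hM (ellNorm_nonneg _ _)) (by norm_num) (by norm_num) _ fun f => ?_
  have h1 := h f g
  have h2 : ∑ x, (∑ y, k x y * g y) * f x = ∑ x, ∑ y, k x y * f x * g y := by
    refine Finset.sum_congr rfl fun x _ => ?_
    rw [Finset.sum_mul]
    exact Finset.sum_congr rfl fun y _ => by ring
  rw [h2]
  norm_num at h1 ⊢
  linarith

/-- The converse direction of T T*. It turns the ℓ² bound for the centered kernel into the ℓ² × ℓ²
hypothesis of `bilinBound_phaseKernel`. -/
lemma BilinBound.gramKernel_bound {k : X → Y → ℂ} {b M : ℝ} (hM : 0 ≤ M)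
    (h : BilinBound k (1 / 2) b M) : BilinBound (gramKernel k) b b (M ^ 2) := by
  intro g g'
  rw [sum_gramKernel]
  refine (norm_sum_mul_le_ellNorm_half _ _).trans ?_
  have h1 := h.ellNorm_half_le hM g
  have h2 := h.ellNorm_half_le hM (fun y => starRingEnd ℂ (g' y))
  rw [ellNorm_congr (f := fun y => starRingEnd ℂ (g' y)) (g := g')
      (fun y => RCLike.norm_conj _),
    ellNorm_congr (g := fun x => ∑ y, starRingEnd ℂ (k x y) * g' y) (fun x => by
      rw [← RCLike.norm_conj, map_sum]; simp)] at h2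
  have := ellNorm_nonneg (1 / 2) (fun x => ∑ y, k x y * g y)
  have := ellNorm_nonneg (1 / 2) (fun x => ∑ y, starRingEnd ℂ (k x y) * g' y)
  have := ellNorm_nonneg b g
  calc _ ≤ (M * ellNorm b g) * (M * ellNorm b g') := by gcongr
    _ = _ := by ring

lemma BilinBound.restrict_right {k : X → Y → ℂ} {a b M : ℝ} (hb : 0 < b) (h : BilinBound k a b M)
    (s : Finset Y) : BilinBound (fun x (y : s) => k x y) a b M := by
  classical
  intro f g
  let g' : Y → ℂ := fun y => if hy : y ∈ s then g ⟨y, hy⟩ else 0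
  have h1 := h f g'
  have h2 : ellNorm b g' = ellNorm b g := by
    unfold ellNorm
    congr 1
    rw [← Finset.sum_subset (Finset.subset_univ s), ← Finset.sum_coe_sort s]
    · refine Finset.sum_congr rfl fun y _ => ?_
      simp [g']
    · intro y _ hy
      simp [g', hy, Real.zero_rpow (inv_ne_zero hb.ne')]
  rw [h2] at h1
  refine le_of_eq_of_le ?_ h1
  congr 1
  refine Finset.sum_congr rfl fun x _ => ?_
  rw [← Finset.sum_subset (Finset.subset_univ s), ← Finset.sum_coe_sort s]
  · refine Finset.sum_congr rfl fun y _ => ?_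
    simp [g']
  · intro y _ hy
    simp [g', hy]

end Bilinear

/-! ### Exponential sums of a nondegenerate quadratic form -/

section QuadraticSums

open QuadraticMap

variable {F V : Type*} [Field F] [AddCommGroup V] [Module F V]
  (ψ : AddChar F ℂ) (Q : QuadraticForm F V)

lemma quadratic_add (x y : V) : Q (x + y) = Q x + Q y + polar Q x y := by
  simp [polar]

lemma quadratic_sub (x y : V) : Q (x - y) = Q x + Q y - polar Q x y := by
  rw [sub_eq_add_neg, quadratic_add, polar_neg_right, QuadraticMap.map_neg]; ring

variable {ψ Q}

open Classical in
variable (Q) in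
/-- The indicator of `Q (y - x) = 0` minus its expected density `1 / |F|`. -/
noncomputable def centeredKernel [Fintype F] (x y : V) : ℂ :=
  (if Q (y - x) = 0 then 1 else 0) - 1 / (Fintype.card F : ℂ)

lemma indicator_eq_sum_addChar [Fintype F] [DecidableEq F] (hψ : ψ.IsPrimitive) (c : F) :
    (if c = 0 then (1 : ℂ) else 0) = (1 / (Fintype.card F : ℂ)) * ∑ t, ψ (t * c) := by
  rw [AddChar.sum_mulShift c hψ]
  have : (Fintype.card F : ℂ) ≠ 0 := by simp
  split_ifs <;> simp [this]

-- The frequency t = 0 contributes exactly the density 1/|F|, which the centering removes.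
open Classical in
lemma centeredKernel_eq [Fintype F] (hψ : ψ.IsPrimitive) (x y : V) : centeredKernel Q x y =
    (1 / (Fintype.card F : ℂ)) * ∑ t ∈ Finset.univ.erase (0 : F), ψ (t * Q (y - x)) := by
  rw [centeredKernel, indicator_eq_sum_addChar hψ,
    ← Finset.add_sum_erase _ _ (Finset.mem_univ (0 : F))]
  simp; ring

lemma conj_centeredKernel [Fintype F] (x y : V) :
    starRingEnd ℂ (centeredKernel Q x y) = centeredKernel Q x y := by
  unfold centeredKernel
  split_ifs <;> simp

lemma centeredKernel_comm [Fintype F] (x y : V) : centeredKernel Q x y = centeredKernel Q y x := by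
  unfold centeredKernel
  rw [QuadraticMap.map_sub]

lemma norm_centeredKernel_le [Fintype F] (x y : V) : ‖centeredKernel Q x y‖ ≤ 1 := by
  classical
  have h1 : (1 : ℝ) ≤ Fintype.card F := by exact_mod_cast Fintype.card_pos
  have h2 : 1 / (Fintype.card F : ℝ) ≤ 1 := by rw [div_le_one (by linarith)]; exact h1
  have h3 : 0 ≤ 1 / (Fintype.card F : ℝ) := by positivity
  have : centeredKernel Q x y =
      (((if Q (y - x) = 0 then 1 else 0) - 1 / (Fintype.card F : ℝ) : ℝ) : ℂ) := by
    unfold centeredKernel; split_ifs <;> simp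
  rw [this, Complex.norm_real, Real.norm_eq_abs, abs_le]
  split_ifs <;> constructor <;> linarith

variable [Fintype V]

/-- Nondegeneracy makes y ↦ ψ(polar Q y v) a nontrivial additive character of V, and such a
character sums to zero. -/
lemma sum_addChar_polar (hψ : ψ.IsPrimitive) (hQ : ∀ v : V, v ≠ 0 → ∃ y, polar Q y v ≠ 0)
    {v : V} (hv : v ≠ 0) : ∑ y, ψ (polar Q y v) = 0 := by
  obtain ⟨y, hy⟩ := hQ v hv
  let φ : V →+ F := (Q.polarBilin.flip v).toAddMonoidHom
  have hφ : ∀ y, φ y = polar Q y v := fun _ => rfl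
  have h : ψ.compAddMonoidHom φ ≠ 0 := by
    intro h
    apply hψ one_ne_zero
    ext a
    have h1 := DFunLike.congr_fun h ((a / polar Q y v) • y)
    rw [AddChar.compAddMonoidHom_apply, hφ, polar_smul_left, smul_eq_mul,
      div_mul_cancel₀ _ hy] at h1
    simpa [AddChar.mulShift_apply] using h1
  exact AddChar.sum_eq_zero_iff_ne_zero.2 h

variable (ψ Q) in
/-- The exponential sum over two translates of a quadratic form and the form itself. -/
noncomputable def phaseSum (u t t' : F) (x x' : V) : ℂ :=
  ∑ y, ψ (u * Q y + t * Q (y - x) + t' * Q (y - x'))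

/-- The quadratic part in y has coefficient u + t + t'. Whether it vanishes decides between a Gauss
sum and the sum of a linear character. -/
lemma phaseSum_eq (u t t' : F) (x x' : V) : phaseSum ψ Q u t t' x x' =
    ∑ y, ψ ((u + t + t') * Q y - polar Q y (t • x + t' • x') + (t * Q x + t' * Q x')) := by
  unfold phaseSum
  refine Finset.sum_congr rfl fun y _ => ?_
  congr 1
  simp only [quadratic_sub, polar_add_right, polar_smul_right, smul_eq_mul]
  ring

open Classical in
lemma card_filter_smul_add_smul_le {t' : F} (ht' : t' ≠ 0) (w : V) :
    ((Finset.univ : Finset V).filter fun x' => w + t' • x' = 0).card ≤ 1 := by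
  refine Finset.card_le_one.2 fun x hx y hy => ?_
  simp only [Finset.mem_filter, Finset.mem_univ, true_and] at hx hy
  have : t' • x = t' • y := add_left_cancel (hx.trans hy.symm)
  exact smul_right_injective V ht' this

variable [Fintype F]

/-- Square-root cancellation for nondegenerate quadratic Gauss sums. -/
lemma norm_sum_addChar_quadratic_le (hψ : ψ.IsPrimitive)
    (hQ : ∀ v : V, v ≠ 0 → ∃ y, polar Q y v ≠ 0) {a : F} (ha : a ≠ 0) (v : V) (c : F) :
    ‖∑ y, ψ (a * Q y - polar Q y v + c)‖ ≤ √(Fintype.card V) := by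
  classical
  apply Real.le_sqrt_of_sq_le
  set S := ∑ y, ψ (a * Q y - polar Q y v + c) with hS
  have h1 : S * starRingEnd ℂ S = (Fintype.card V : ℂ) := by
    -- Weyl differencing: after y' = y + h the terms quadratic in y cancel, leaving a linear
    -- character in y that sums to zero unless h = 0.
    have h2 : S * starRingEnd ℂ S =
        ∑ y, ∑ h, ψ (a * Q h - polar Q h v) * ψ (polar Q y (a • h)) := by
      rw [mul_comm, hS, map_sum, Finset.sum_mul_sum]
      refine Finset.sum_congr rfl fun y _ => ?_
      rw [← Equiv.sum_comp (Equiv.addLeft y)]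
      refine Finset.sum_congr rfl fun h _ => ?_
      rw [← AddChar.map_neg_eq_conj, ← AddChar.map_add_eq_mul, ← AddChar.map_add_eq_mul]
      congr 1
      simp only [Equiv.coe_addLeft, quadratic_add, polar_add_left, polar_smul_right, smul_eq_mul]
      ring
    rw [h2, Finset.sum_comm, Finset.sum_eq_single 0]
    · simp [Finset.card_univ]
    · intro h _ hh
      rw [← Finset.mul_sum, sum_addChar_polar hψ hQ (smul_ne_zero ha hh), mul_zero]
    · simp
  rw [Complex.mul_conj, Complex.normSq_eq_norm_sq] at h1
  have h2 : ‖S‖ ^ 2 = (Fintype.card V : ℝ) := by exact_mod_cast h1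
  exact h2.le

lemma norm_phaseSum_le_sqrt (hψ : ψ.IsPrimitive)
    (hQ : ∀ v : V, v ≠ 0 → ∃ y, polar Q y v ≠ 0) {u t t' : F} (h : u + t + t' ≠ 0) (x x' : V) :
    ‖phaseSum ψ Q u t t' x x'‖ ≤ √(Fintype.card V) := by
  rw [phaseSum_eq]
  exact norm_sum_addChar_quadratic_le hψ hQ h _ _

-- With no quadratic term the phase is a constant plus a linear function of y, so the sum vanishes
-- unless that function is zero.
open Classical in
lemma norm_phaseSum_le_of_sum_eq_zero (hψ : ψ.IsPrimitive)
    (hQ : ∀ v : V, v ≠ 0 → ∃ y, polar Q y v ≠ 0) {u t t' : F} (h : u + t + t' = 0) (x x' : V) :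
    ‖phaseSum ψ Q u t t' x x'‖ ≤ if t • x + t' • x' = 0 then (Fintype.card V : ℝ) else 0 := by
  rw [phaseSum_eq, h]
  split_ifs with hx
  · refine (norm_sum_le _ _).trans ?_
    simp_rw [AddChar.norm_apply]
    simp
  · have : ∀ y, ψ (0 * Q y - polar Q y (t • x + t' • x') + (t * Q x + t' * Q x')) =
        ψ (polar Q y (-(t • x + t' • x'))) * ψ (t * Q x + t' * Q x') := fun y => by
      rw [← AddChar.map_add_eq_mul, polar_neg_right]; ring_nf
    simp_rw [this, ← Finset.sum_mul]
    rw [sum_addChar_polar hψ hQ (neg_ne_zero.2 hx)]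
    simp

open Classical in
variable (ψ Q) in
/-- The average of `phaseSum` over `u ∈ U`, `t ≠ 0`, `t' ≠ 0`, divided by `|F|²`. -/
noncomputable def phaseKernel (U : Finset F) (x x' : V) : ℂ :=
  (1 / ((U.card : ℂ) * (Fintype.card F : ℂ) ^ 2)) *
    ∑ p ∈ U ×ˢ (Finset.univ.erase (0 : F) ×ˢ Finset.univ.erase (0 : F)),
      phaseSum ψ Q p.1 p.2.1 p.2.2 x x'

/-- Interpolated bound for `phaseKernel`: the part with square-root cancellation is interpolated
between `ℓ¹ × ℓ¹` and `ℓ² × ℓ²`, the rest is controlled by Schur's test. -/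
lemma bilinBound_phaseKernel (hψ : ψ.IsPrimitive)
    (hQ : ∀ v : V, v ≠ 0 → ∃ y, polar Q y v ≠ 0) {d : ℕ} (hd : 2 ≤ d)
    (hV : Fintype.card V = Fintype.card F ^ d) {U : Finset F} (hU : U.Nonempty)
    (h2 : BilinBound (phaseKernel ψ Q U) (1 / 2) (1 / 2) (Fintype.card V)) :
    BilinBound (phaseKernel ψ Q U) (1 / 2 + 1 / d) (1 / 2 + 1 / d)
      (3 * (Fintype.card F : ℝ) ^ (d - 1)) := by
  classical
  set q : ℝ := (Fintype.card F : ℝ) with hq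
  set N : ℝ := (Fintype.card V : ℝ) with hN
  have hNq : N = q ^ d := by rw [hN, hV]; push_cast; rfl
  have hq1 : 1 < q := by rw [hq]; exact_mod_cast Fintype.one_lt_card
  have hq0 : 0 < q := by linarith
  have hN0 : 0 < N := by rw [hNq]; positivity
  have hNq' : N / q = q ^ (d - 1) := by
    rw [hNq, div_eq_iff hq0.ne', ← pow_succ]; congr 1; omega
  have hUc : (0 : ℝ) < U.card := by exact_mod_cast hU.card_pos
  set T := U ×ˢ (Finset.univ.erase (0 : F) ×ˢ Finset.univ.erase (0 : F)) with hT
  set w : ℂ := 1 / ((U.card : ℂ) * (Fintype.card F : ℂ) ^ 2) with hw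
  have hwn : ‖w‖ = 1 / (U.card * q ^ 2) := by simp [hw, hq]
  -- `A` collects the Gauss sums, `D` the triples whose quadratic coefficient vanishes.
  let A : V → V → ℂ := fun x x' =>
    w * ∑ p ∈ T.filter (fun p => ¬ p.1 + p.2.1 + p.2.2 = 0), phaseSum ψ Q p.1 p.2.1 p.2.2 x x'
  let D : V → V → ℂ := fun x x' =>
    w * ∑ p ∈ T.filter (fun p => p.1 + p.2.1 + p.2.2 = 0), phaseSum ψ Q p.1 p.2.1 p.2.2 x x'
  have hAD : ∀ x x', phaseKernel ψ Q U x x' = A x x' + D x x' := fun x x' => by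
    simp only [A, D, ← mul_add]
    rw [add_comm, Finset.sum_filter_add_sum_filter_not]; rfl
  have hTcard : (T.card : ℝ) ≤ U.card * q ^ 2 := by
    have : T.card ≤ U.card * (Fintype.card F * Fintype.card F) := by
      rw [hT, Finset.card_product, Finset.card_product]
      have := Finset.card_le_univ (Finset.univ.erase (0 : F))
      gcongr
    rw [hq, pow_two]; exact_mod_cast this
  -- On this set u and t determine t', which saves a factor q over the full set of triples.
  have hT0card : ((T.filter (fun p => p.1 + p.2.1 + p.2.2 = 0)).card : ℝ) ≤ U.card * q := by
    have : (T.filter (fun p => p.1 + p.2.1 + p.2.2 = 0)).card ≤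
        (U ×ˢ (Finset.univ : Finset F)).card := by
      refine Finset.card_le_card_of_injOn (fun p => (p.1, p.2.1)) ?_ ?_
      · intro p hp
        simp only [hT, Finset.coe_filter, Finset.mem_product, Set.mem_ofPred_eq] at hp
        simp [hp.1.1]
      · rintro ⟨u, t, t'⟩ hp ⟨u₁, t₁, t₁'⟩ hp' h
        simp only [Finset.coe_filter, Set.mem_ofPred_eq] at hp hp'
        simp only [Prod.mk.injEq] at h
        obtain ⟨rfl, rfl⟩ := h
        have := hp.2.trans hp'.2.symm
        simpa using this
    rw [Finset.card_product, Finset.card_univ] at this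
    rw [hq]; exact_mod_cast this
  have hA1 : BilinBound A 1 1 (√N) := by
    refine bilinBound_one_one fun x x' => ?_
    simp only [A]
    rw [norm_mul, hwn, one_div_mul_eq_div, div_le_iff₀ (by positivity)]
    refine (norm_sum_le _ _).trans ?_
    refine (Finset.sum_le_card_nsmul _ _ (√N) fun p hp => ?_).trans ?_
    · rw [Finset.mem_filter] at hp
      exact norm_phaseSum_le_sqrt hψ hQ hp.2 x x'
    · rw [nsmul_eq_mul, mul_comm]
      gcongr
      refine le_trans ?_ hTcard
      exact_mod_cast Finset.card_filter_le _ _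
  have hrow : ∀ R : V → F × F × F → Prop,
      (∀ p ∈ T, ((Finset.univ : Finset V).filter fun x' => R x' p).card ≤ 1) →
      ∑ x', (1 / (U.card * q ^ 2)) * ∑ p ∈ T.filter (fun p => p.1 + p.2.1 + p.2.2 = 0),
        (if R x' p then N else 0) ≤ N / q := by
    intro R hR
    rw [← Finset.mul_sum, Finset.sum_comm, one_div_mul_eq_div, div_le_iff₀ (by positivity)]
    refine (Finset.sum_le_card_nsmul _ _ N fun p hp => ?_).trans ?_
    · rw [← Finset.sum_filter, Finset.sum_const, nsmul_eq_mul]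
      have : (((Finset.univ : Finset V).filter fun x' => R x' p).card : ℝ) ≤ 1 := by
        exact_mod_cast hR p (Finset.mem_filter.1 hp).1
      nlinarith
    · rw [nsmul_eq_mul]
      calc _ ≤ (U.card * q) * N := by gcongr
        _ = _ := by field_simp
  have hDn : ∀ x x', ‖D x x'‖ ≤ (1 / (U.card * q ^ 2)) *
      ∑ p ∈ T.filter (fun p => p.1 + p.2.1 + p.2.2 = 0),
        (if p.2.1 • x + p.2.2 • x' = 0 then N else 0) := fun x x' => by
    simp only [D]
    rw [norm_mul, hwn]
    refine mul_le_mul_of_nonneg_left ((norm_sum_le _ _).trans (Finset.sum_le_sum fun p hp => ?_))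
      (by positivity)
    rw [Finset.mem_filter] at hp
    convert norm_phaseSum_le_of_sum_eq_zero hψ hQ hp.2 x x'
  -- Since t and t' are nonzero, each triple contributes at most one entry N per row and per column.
  have hD2 : BilinBound D (1 / 2) (1 / 2) (N / q) := by
    refine bilinBound_half_half (by positivity) (fun x => ?_) (fun x' => ?_)
    · refine (Finset.sum_le_sum fun x' _ => hDn x x').trans
        (hrow (fun x' p => p.2.1 • x + p.2.2 • x' = 0) fun p hp => ?_)
      simp only [hT, Finset.mem_product, Finset.mem_erase] at hp
      convert card_filter_smul_add_smul_le hp.2.2.1 (p.2.1 • x)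
    · refine (Finset.sum_le_sum fun x _ => hDn x x').trans
        (hrow (fun x p => p.2.1 • x + p.2.2 • x' = 0) fun p hp => ?_)
      simp only [hT, Finset.mem_product, Finset.mem_erase] at hp
      simp_rw [add_comm _ (p.2.2 • x')]
      convert card_filter_smul_add_smul_le hp.2.1.1 (p.2.2 • x')
  -- There is no direct ℓ² bound for `A`: it is obtained by subtracting `D` from the whole kernel.
  have hA2 : BilinBound A (1 / 2) (1 / 2) (2 * N) := by
    have h3 := h2.add (hD2.const_mul (-1))
    have h4 : (fun x x' => phaseKernel ψ Q U x x' + -1 * D x x') = A := by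
      funext x x'; rw [hAD]; ring
    rw [h4] at h3
    refine h3.mono ?_
    have : N / q ≤ N := div_le_self hN0.le hq1.le
    simp only [norm_neg, norm_one, one_mul]
    linarith
  have hd0 : (0 : ℝ) < d := by positivity
  have hd2 : (2 : ℝ) ≤ d := by exact_mod_cast hd
  have hθ0 : 0 ≤ 1 - 2 / (d : ℝ) := by
    rw [sub_nonneg, div_le_one hd0]; exact hd2
  have hθ1 : 1 - 2 / (d : ℝ) ≤ 1 := by
    have : 0 ≤ 2 / (d : ℝ) := by positivity
    linarith
  -- The choice θ = 1 - 2/d reaches the exponent 1/2 + 1/d, and there √N^{2/d} N^{1-2/d} = q ·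
  -- q^{d-2} = q^{d-1}, the same size as the bound for `D`.
  have hA3 := hA1.interpolate hA2 one_pos one_pos (by norm_num) (by norm_num) hθ0 hθ1
  have he : (1 - (1 - 2 / (d : ℝ))) * 1 + (1 - 2 / (d : ℝ)) * (1 / 2) = 1 / 2 + 1 / d := by
    field_simp; ring
  rw [he] at hA3
  have hM : √N ^ (1 - (1 - 2 / (d : ℝ))) * (2 * N) ^ (1 - 2 / (d : ℝ)) ≤ 2 * (N / q) := by
    have h5 : √N ^ (1 - (1 - 2 / (d : ℝ))) = q := by
      rw [Real.sqrt_eq_rpow, ← Real.rpow_mul hN0.le, hNq, ← Real.rpow_natCast q d,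
        ← Real.rpow_mul hq0.le]
      have : (d : ℝ) * (1 / 2 * (1 - (1 - 2 / d))) = 1 := by field_simp; ring
      rw [this, Real.rpow_one]
    have h6 : N ^ (1 - 2 / (d : ℝ)) = N / q ^ 2 := by
      rw [Real.rpow_sub hN0, Real.rpow_one]
      congr 1
      rw [hNq, ← Real.rpow_natCast q d, ← Real.rpow_mul hq0.le,
        mul_div_cancel₀ _ hd0.ne']
      exact_mod_cast Real.rpow_natCast q 2
    rw [h5, Real.mul_rpow (by norm_num) hN0.le, h6]
    have h7 : (2 : ℝ) ^ (1 - 2 / (d : ℝ)) ≤ 2 := by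
      calc (2 : ℝ) ^ (1 - 2 / (d : ℝ)) ≤ 2 ^ (1 : ℝ) :=
            Real.rpow_le_rpow_of_exponent_le (by norm_num) hθ1
        _ = 2 := Real.rpow_one 2
    calc q * (2 ^ (1 - 2 / (d : ℝ)) * (N / q ^ 2)) ≤ q * (2 * (N / q ^ 2)) := by gcongr
      _ = _ := by field_simp
  have h12 : (1 : ℝ) / 2 ≤ 1 / 2 + 1 / d := by
    have : 0 ≤ 1 / (d : ℝ) := by positivity
    linarith
  -- The Schur bound for `D` is transferred from ℓ² to the larger reciprocal exponent by nesting of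
  -- counting norms.
  have hD3 := hD2.mono_exponent (by positivity) (by norm_num) (by norm_num) h12 h12
  have h8 := (hA3.mono hM).add hD3
  have h9 : (fun x x' => A x x' + D x x') = phaseKernel ψ Q U := by
    funext x x'; rw [hAD]
  rw [h9] at h8
  refine h8.mono (le_of_eq ?_)
  rw [← hNq']; ring

/-- `L²` bound: each kernel `ψ (t * Q (y - x))`, `t ≠ 0`, is a multiple of a unitary matrix. -/
lemma bilinBound_centeredKernel_half_half (hψ : ψ.IsPrimitive)
    (hQ : ∀ v : V, v ≠ 0 → ∃ y, polar Q y v ≠ 0) :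
    BilinBound (centeredKernel Q) (1 / 2) (1 / 2) (√(Fintype.card V)) := by
  classical
  have h1 : ∀ t ∈ Finset.univ.erase (0 : F),
      BilinBound (fun x y : V => ψ (t * Q (y - x))) (1 / 2) (1 / 2) (√(Fintype.card V)) := by
    intro t ht
    have ht : t ≠ 0 := by simpa using ht
    refine BilinBound.of_gramKernel (Real.sqrt_nonneg _) ?_
    rw [Real.sq_sqrt (by positivity)]
    have hg : ∀ y y' : V, ‖gramKernel (fun x y : V => ψ (t * Q (y - x))) y y'‖ =
        if y = y' then (Fintype.card V : ℝ) else 0 := by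
      intro y y'
      have h2 : gramKernel (fun x y : V => ψ (t * Q (y - x))) y y' =
          ψ (t * (Q y - Q y')) * ∑ x, ψ (polar Q x (t • (y' - y))) := by
        rw [gramKernel, Finset.mul_sum]
        refine Finset.sum_congr rfl fun x _ => ?_
        rw [← AddChar.map_neg_eq_conj, ← AddChar.map_add_eq_mul, ← AddChar.map_add_eq_mul]
        congr 1
        rw [polar_smul_right, polar_sub_right, quadratic_sub, quadratic_sub, polar_comm Q y x,
          polar_comm Q y' x, smul_eq_mul]
        ring
      rw [h2]
      split_ifs with h
      · simp [h]
      · rw [sum_addChar_polar hψ hQ (smul_ne_zero ht (sub_ne_zero.2 (Ne.symm h)))]; simp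
    refine bilinBound_half_half (by positivity) (fun y => ?_) (fun y' => ?_)
    · simp [hg]
    · simp [hg]
  have h2 := (BilinBound.sum _ h1).const_mul (1 / (Fintype.card F : ℂ))
  have h3 : (fun x y : V => (1 / (Fintype.card F : ℂ)) *
      ∑ t ∈ Finset.univ.erase (0 : F), ψ (t * Q (y - x))) = centeredKernel Q := by
    funext x y; rw [centeredKernel_eq hψ]
  rw [h3] at h2
  refine h2.mono ?_
  have hq : (0 : ℝ) < Fintype.card F := by exact_mod_cast Fintype.card_pos
  rw [norm_div, norm_one, Complex.norm_natCast, ← mul_assoc]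
  refine mul_le_of_le_one_left (Real.sqrt_nonneg _) ?_
  rw [one_div_mul_eq_div, div_le_one hq]
  exact_mod_cast Finset.card_le_univ _

/-- The inner variable runs over all of V, so no third frequency is needed and u = 0. -/
lemma gramKernel_centeredKernel (hψ : ψ.IsPrimitive) (y y' : V) :
    gramKernel (centeredKernel Q) y y' = phaseKernel ψ Q {0} y y' := by
  classical
  simp only [gramKernel, phaseKernel, conj_centeredKernel]
  rw [Finset.sum_product, Finset.sum_singleton, Finset.sum_product]
  simp_rw [centeredKernel_comm _ y, centeredKernel_comm _ y', centeredKernel_eq hψ,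
    phaseSum, mul_mul_mul_comm _ _ (1 / (Fintype.card F : ℂ)), Finset.sum_mul_sum]
  rw [← Finset.mul_sum]
  congr 1
  · simp; ring
  rw [Finset.sum_comm]
  refine Finset.sum_congr rfl fun t _ => ?_
  rw [Finset.sum_comm]
  refine Finset.sum_congr rfl fun t' _ => Finset.sum_congr rfl fun z _ => ?_
  rw [← AddChar.map_add_eq_mul]; simp

/-- The inner variable is confined to the cone; expanding its indicator in characters introduces the
frequency u, averaged over the whole field. -/
lemma gramKernel_centeredKernel_flip (hψ : ψ.IsPrimitive) {C : Finset V}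
    (hC : ∀ y, y ∈ C ↔ Q y = 0) (x x' : V) :
    gramKernel (fun (y : C) (x : V) => centeredKernel Q x y) x x' =
      phaseKernel ψ Q Finset.univ x x' := by
  classical
  have h1 : gramKernel (fun (y : C) (x : V) => centeredKernel Q x y) x x' =
      ∑ y, (if Q y = 0 then (1 : ℂ) else 0) * (centeredKernel Q x y * centeredKernel Q x' y) := by
    simp only [gramKernel, conj_centeredKernel]
    rw [Finset.sum_coe_sort C (fun y => centeredKernel Q x y * centeredKernel Q x' y)]
    simp_rw [ite_mul, one_mul, zero_mul]
    rw [← Finset.sum_filter]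
    refine Finset.sum_congr ?_ fun _ _ => rfl
    ext y; simp [hC]
  rw [h1, phaseKernel]
  rw [Finset.sum_product]
  simp_rw [Finset.sum_product, indicator_eq_sum_addChar hψ, centeredKernel_eq hψ, phaseSum,
    mul_mul_mul_comm, Finset.sum_mul_sum, Finset.mul_sum]
  rw [Finset.sum_comm]
  refine Finset.sum_congr rfl fun u _ => ?_
  rw [Finset.sum_comm]
  refine Finset.sum_congr rfl fun t _ => ?_
  rw [Finset.sum_comm]
  refine Finset.sum_congr rfl fun t' _ => Finset.sum_congr rfl fun y _ => ?_
  rw [AddChar.map_add_eq_mul, AddChar.map_add_eq_mul, Finset.card_univ]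
  have : (Fintype.card F : ℂ) ≠ 0 := by simp
  field_simp

/-- The two estimates at distance `1/d` from the `L²` point. -/
lemma bilinBound_centeredKernel_cone (hQ : ∀ v : V, v ≠ 0 → ∃ y, polar Q y v ≠ 0) {d : ℕ}
    (hd : 2 ≤ d) (hV : Fintype.card V = Fintype.card F ^ d) {C : Finset V}
    (hC : ∀ y, y ∈ C ↔ Q y = 0) :
    BilinBound (fun (x : V) (y : C) => centeredKernel Q x y) (1 / 2) (1 / 2 + 1 / d)
      (√(3 * (Fintype.card F : ℝ) ^ (d - 1))) ∧
    BilinBound (fun (x : V) (y : C) => centeredKernel Q x y) (1 / 2 + 1 / d) (1 / 2)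
      (√(3 * (Fintype.card F : ℝ) ^ (d - 1))) := by
  have hψ := AddChar.FiniteField.primitiveChar_to_Complex_isPrimitive F
  set ψ := AddChar.FiniteField.primitiveChar_to_Complex F
  have h0 := bilinBound_centeredKernel_half_half hψ hQ
  have hs : √(Fintype.card V : ℝ) ^ 2 = Fintype.card V := Real.sq_sqrt (by positivity)
  have hs' : √(3 * (Fintype.card F : ℝ) ^ (d - 1)) ^ 2 = 3 * (Fintype.card F : ℝ) ^ (d - 1) :=
    Real.sq_sqrt (by positivity)
  constructor
  -- Here T T* is applied on V × V, and only afterwards is the second variable restricted to C.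
  · refine BilinBound.restrict_right (by positivity)
      (BilinBound.of_gramKernel (Real.sqrt_nonneg _) ?_) C
    have h1 := h0.gramKernel_bound (Real.sqrt_nonneg _)
    have h2 : gramKernel (centeredKernel Q) = phaseKernel ψ Q {0} := by
      funext y y'; exact gramKernel_centeredKernel hψ y y'
    rw [hs, h2] at h1
    rw [hs', h2]
    exact bilinBound_phaseKernel hψ hQ hd hV (by simp) h1
  -- With the variables exchanged, the Gram sum runs over C and the resulting kernel lives on V × V.
  · refine BilinBound.flip (BilinBound.of_gramKernel (Real.sqrt_nonneg _) ?_)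
    have h1 := (h0.restrict_right (by norm_num) C).flip.gramKernel_bound (Real.sqrt_nonneg _)
    have h2 : gramKernel (fun (y : C) (x : V) => centeredKernel Q x y) =
        phaseKernel ψ Q Finset.univ := by
      funext x x'; exact gramKernel_centeredKernel_flip hψ hC x x'
    rw [hs, h2] at h1
    rw [hs', h2]
    exact bilinBound_phaseKernel hψ hQ hd hV ⟨0, by simp⟩ h1

/-- The number of zeros of a nondegenerate quadratic form. -/
lemma abs_card_zeros_sub_le (hQ : ∀ v : V, v ≠ 0 → ∃ y, polar Q y v ≠ 0) {C : Finset V}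
    (hC : ∀ y, y ∈ C ↔ Q y = 0) :
    |(C.card : ℝ) - Fintype.card V / Fintype.card F| ≤ √(Fintype.card V) := by
  classical
  have hψ := AddChar.FiniteField.primitiveChar_to_Complex_isPrimitive F
  set ψ := AddChar.FiniteField.primitiveChar_to_Complex F
  have hq : (0 : ℝ) < Fintype.card F := by exact_mod_cast Fintype.card_pos
  have h1 : ((C.card - Fintype.card V / Fintype.card F : ℝ) : ℂ) =
      (1 / (Fintype.card F : ℂ)) * ∑ t ∈ Finset.univ.erase (0 : F),
        ∑ y : V, ψ (t * Q y - polar Q y 0 + 0) := by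
    have h2 : (C.card : ℂ) = ∑ y : V, if Q y = 0 then (1 : ℂ) else 0 := by
      rw [← Finset.sum_filter, Finset.sum_const, nsmul_eq_mul, mul_one]
      congr 2
      ext y; simp [hC]
    push_cast
    rw [h2]
    simp_rw [indicator_eq_sum_addChar hψ, ← Finset.mul_sum]
    rw [Finset.sum_comm, ← Finset.add_sum_erase _ _ (Finset.mem_univ (0 : F))]
    simp [Finset.card_univ]; ring
  rw [← Real.norm_eq_abs, ← Complex.norm_real, h1, norm_mul, norm_div, norm_one,
    Complex.norm_natCast, one_div_mul_eq_div, div_le_iff₀ hq]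
  refine (norm_sum_le _ _).trans ((Finset.sum_le_card_nsmul _ _ (√(Fintype.card V))
    fun t ht => norm_sum_addChar_quadratic_le hψ hQ (by simpa using ht) _ _).trans ?_)
  rw [nsmul_eq_mul, mul_comm]
  gcongr
  exact_mod_cast Finset.card_le_univ _

end QuadraticSums

/-! ### Normalized norms, indexed by reciprocal exponents -/

section MeanNorm

variable {X : Type*} [Fintype X]

open Classical in
/-- The norm `normLp`, as a function of the reciprocal exponent. -/
noncomputable def meanNorm (a : ℝ) (f : X → ℂ) : ℝ :=
  if a = 0 then ((Finset.univ.sup fun x => ‖f x‖₊ : NNReal) : ℝ)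
  else ((1 / (Fintype.card X : ℝ)) * ∑ x, ‖f x‖ ^ (1 / a)) ^ a

/-- The exponent p = 0 must be excluded: `(0⁻¹).toReal` is 0, the index reserved here for p = ∞. -/
lemma normLp_eq_meanNorm {p : ℝ≥0∞} (hp : p ≠ 0) (f : X → ℂ) :
    normLp p f = meanNorm (p⁻¹).toReal f := by
  unfold normLp meanNorm
  by_cases h : p = ∞
  · simp [h]
  · have h1 : p.toReal ≠ 0 := ENNReal.toReal_ne_zero.2 ⟨hp, h⟩
    rw [if_neg h, if_neg (by rw [ENNReal.toReal_inv]; exact inv_ne_zero h1), ENNReal.toReal_inv]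
    simp

lemma meanNorm_nonneg (a : ℝ) (f : X → ℂ) : 0 ≤ meanNorm a f := by
  unfold meanNorm
  split_ifs
  · exact NNReal.coe_nonneg _
  · positivity

lemma norm_le_meanNorm_zero (f : X → ℂ) (x : X) : ‖f x‖ ≤ meanNorm 0 f := by
  rw [meanNorm, if_pos rfl]
  exact_mod_cast Finset.le_sup (f := fun x => ‖f x‖₊) (Finset.mem_univ x)

lemma meanNorm_zero_le {f : X → ℂ} {M : ℝ} (hM : 0 ≤ M) (h : ∀ x, ‖f x‖ ≤ M) :
    meanNorm 0 f ≤ M := by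
  rw [meanNorm, if_pos rfl]
  lift M to NNReal using hM
  rw [NNReal.coe_le_coe]
  exact Finset.sup_le fun x _ => by exact_mod_cast h x

lemma meanNorm_eq_ellNorm {a : ℝ} (ha : 0 < a) (f : X → ℂ) :
    meanNorm a f = (Fintype.card X : ℝ) ^ (-a) * ellNorm a f := by
  rw [meanNorm, if_neg ha.ne', ellNorm, Real.mul_rpow (by positivity) (by positivity), one_div,
    Real.inv_rpow (by positivity), Real.rpow_neg (by positivity)]

lemma meanNorm_mono {a : ℝ} (ha : 0 ≤ a) {f g : X → ℂ} (h : ∀ x, ‖f x‖ ≤ ‖g x‖) :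
    meanNorm a f ≤ meanNorm a g := by
  rcases ha.eq_or_lt with rfl | ha
  · exact meanNorm_zero_le (meanNorm_nonneg _ _) fun x => (h x).trans (norm_le_meanNorm_zero g x)
  · rw [meanNorm, meanNorm, if_neg ha.ne', if_neg ha.ne']
    gcongr with x
    exact h x

lemma meanNorm_const [Nonempty X] {a : ℝ} (ha : 0 ≤ a) (c : ℂ) :
    meanNorm a (fun _ : X => c) = ‖c‖ := by
  rcases ha.eq_or_lt with rfl | ha
  · exact le_antisymm (meanNorm_zero_le (norm_nonneg _) fun _ => le_rfl)
      (norm_le_meanNorm_zero (fun _ : X => c) (Classical.arbitrary X))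
  · have : (Fintype.card X : ℝ) ≠ 0 := by simp
    rw [meanNorm, if_neg ha.ne', Finset.sum_const, Finset.card_univ, nsmul_eq_mul, ← mul_assoc,
      one_div_mul_cancel this, one_mul, ← Real.rpow_mul (norm_nonneg _),
      one_div_mul_cancel ha.ne', Real.rpow_one]

/-- Norms with respect to a probability measure increase with the exponent. -/
lemma meanNorm_anti [Nonempty X] {a b : ℝ} (hb : 0 ≤ b) (hab : b ≤ a) (f : X → ℂ) :
    meanNorm a f ≤ meanNorm b f := by
  rcases hb.eq_or_lt with rfl | hb
  · rw [← abs_of_nonneg (meanNorm_nonneg 0 f), ← Real.norm_eq_abs, ← Complex.norm_real,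
      ← meanNorm_const (X := X) hab]
    refine meanNorm_mono hab fun x => ?_
    rw [Complex.norm_real, Real.norm_of_nonneg (meanNorm_nonneg _ _)]
    exact norm_le_meanNorm_zero f x
  · have ha : 0 < a := hb.trans_le hab
    have hc : (Fintype.card X : ℝ) ≠ 0 := by simp
    have h1 := Real.rpow_arith_mean_le_arith_mean_rpow (Finset.univ : Finset X)
      (fun _ => 1 / (Fintype.card X : ℝ)) (fun x => ‖f x‖ ^ (1 / a)) (fun _ _ => by positivity)
      (by simp [hc]) (fun _ _ => by positivity) (p := a / b) ((one_le_div hb).2 hab)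
    have h2 : ∀ x, (‖f x‖ ^ (1 / a)) ^ (a / b) = ‖f x‖ ^ (1 / b) := fun x => by
      rw [← Real.rpow_mul (norm_nonneg _)]; congr 1; field_simp
    simp_rw [h2, ← Finset.mul_sum] at h1
    rw [meanNorm, meanNorm, if_neg ha.ne', if_neg hb.ne']
    refine le_trans (le_of_eq ?_) (Real.rpow_le_rpow (by positivity) h1 hb.le)
    rw [← Real.rpow_mul (by positivity), div_mul_cancel₀ _ hb.ne']

lemma meanNorm_add_le {a : ℝ} (ha : 0 < a) (ha1 : a ≤ 1) (f g : X → ℂ) :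
    meanNorm a (fun x => f x + g x) ≤ meanNorm a f + meanNorm a g := by
  rw [meanNorm_eq_ellNorm ha, meanNorm_eq_ellNorm ha, meanNorm_eq_ellNorm ha, ← mul_add]
  refine mul_le_mul_of_nonneg_left ?_ (by positivity)
  have h := Real.Lp_add_le_of_nonneg (Finset.univ : Finset X) (f := fun x => ‖f x‖)
    (g := fun x => ‖g x‖) (p := 1 / a) ((one_le_div ha).2 ha1) (fun _ _ => norm_nonneg _)
    (fun _ _ => norm_nonneg _)
  rw [one_div_one_div] at h
  refine le_trans ?_ h
  unfold ellNorm
  gcongr with x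
  exact norm_add_le _ _

lemma meanNorm_smul {a : ℝ} (ha : 0 < a) (c : ℂ) (f : X → ℂ) :
    meanNorm a (fun x => c * f x) = ‖c‖ * meanNorm a f := by
  rw [meanNorm_eq_ellNorm ha, meanNorm_eq_ellNorm ha, ellNorm_smul ha]; ring

lemma meanNorm_rpow {a k : ℝ} (ha : 0 < a) (hk : 0 < k) (f : X → ℂ) :
    meanNorm a (fun x => ((‖f x‖ ^ k : ℝ) : ℂ)) = meanNorm (a / k) f ^ k := by
  rw [meanNorm, meanNorm, if_neg ha.ne', if_neg (by positivity), ← Real.rpow_mul (by positivity),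
    div_mul_cancel₀ _ hk.ne']
  congr 3
  funext x
  rw [Complex.norm_real, Real.norm_of_nonneg (by positivity), ← Real.rpow_mul (norm_nonneg _)]
  congr 1; field_simp

end MeanNorm

/-! ### The form of the cone: nondegeneracy and number of zeros -/

section ConeForm

open QuadraticMap

variable (F : Type*) [Field F] (d : ℕ) (hd : 3 ≤ d)

/-- The quadratic form whose zero set is the cone. -/
noncomputable def coneForm : QuadraticForm F (Fin d → F) :=
  (∑ i : Fin (d - 2), linMulLin (LinearMap.proj (Fin.castLE (Nat.sub_le d 2) i))
    (LinearMap.proj (Fin.castLE (Nat.sub_le d 2) i))) -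
  linMulLin (LinearMap.proj ⟨d - 2, by omega⟩) (LinearMap.proj ⟨d - 1, by omega⟩)

lemma coneForm_apply (x : Fin d → F) : coneForm F d hd x =
    ∑ i : Fin (d - 2), x (Fin.castLE (Nat.sub_le d 2) i) ^ 2 -
      x ⟨d - 2, by omega⟩ * x ⟨d - 1, by omega⟩ := by
  simp [coneForm, pow_two]

lemma mem_cone_iff [Fintype F] (x : Fin d → F) : x ∈ cone F d hd ↔ coneForm F d hd x = 0 := by
  simp [cone, coneForm_apply, sub_eq_zero]

lemma polar_coneForm (x y : Fin d → F) : polar (coneForm F d hd) x y =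
    2 * ∑ i : Fin (d - 2), x (Fin.castLE (Nat.sub_le d 2) i) * y (Fin.castLE (Nat.sub_le d 2) i) -
      x ⟨d - 2, by omega⟩ * y ⟨d - 1, by omega⟩ - x ⟨d - 1, by omega⟩ * y ⟨d - 2, by omega⟩ := by
  simp only [polar, coneForm_apply, Pi.add_apply, add_sq, Finset.sum_add_distrib, Finset.mul_sum,
    mul_assoc]
  ring

lemma two_ne_zero_of_odd_card [Fintype F] (hF : Odd (Fintype.card F)) : (2 : F) ≠ 0 := by
  intro h
  have h2 : ringChar F = 2 := by
    rcases (Nat.dvd_prime Nat.prime_two).1 (ringChar.dvd (R := F) (x := 2) (by exact_mod_cast h))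
      with h1 | h1
    · exact absurd h1 (CharP.ringChar_ne_one)
    · exact h1
  have := FiniteField.even_card_iff_char_two.1 h2
  exact (Nat.not_odd_iff.2 this) hF

lemma coneForm_nondegenerate (h2 : (2 : F) ≠ 0) (v : Fin d → F) (hv : v ≠ 0) :
    ∃ y, polar (coneForm F d hd) y v ≠ 0 := by
  classical
  by_contra! h
  apply hv
  simp_rw [polar_coneForm] at h
  -- Testing on the last two basis vectors kills the hyperbolic coordinates of v; the other basis
  -- vectors give 2 v_i = 0.
  have h1 := h (Pi.single ⟨d - 1, by omega⟩ 1)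
  have h3 := h (Pi.single ⟨d - 2, by omega⟩ 1)
  have e1 : ∀ i : Fin (d - 2), Fin.castLE (Nat.sub_le d 2) i ≠ ⟨d - 1, by omega⟩ := fun i => by
    have := i.2
    simp [Fin.ext_iff]; omega
  have e2 : ∀ i : Fin (d - 2), Fin.castLE (Nat.sub_le d 2) i ≠ ⟨d - 2, by omega⟩ := fun i => by
    have := i.2
    simp [Fin.ext_iff]; omega
  have e3 : (⟨d - 2, by omega⟩ : Fin d) ≠ ⟨d - 1, by omega⟩ := by simp [Fin.ext_iff]; omega
  simp [e1, e3] at h1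
  simp [e2, e3.symm] at h3
  funext i
  by_cases hi : i.1 < d - 2
  · have h4 := h (Pi.single i 1)
    have e4 : i = Fin.castLE (Nat.sub_le d 2) ⟨i.1, hi⟩ := rfl
    have e5 := e1 ⟨i.1, hi⟩
    have e6 := e2 ⟨i.1, hi⟩
    rw [← e4] at e5 e6
    rw [Finset.sum_eq_single ⟨i.1, hi⟩] at h4
    · simp [e5.symm, e6.symm, ← e4, h2] at h4
      exact h4
    · intro j _ hj
      rw [Pi.single_eq_of_ne, zero_mul]
      intro h5
      apply hj
      rw [e4] at h5
      exact Fin.castLE_injective _ h5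
    · simp
  · rcases (by omega : i.1 = d - 2 ∨ i.1 = d - 1) with h5 | h5
    · have : i = ⟨d - 2, by omega⟩ := Fin.ext h5
      rw [this]; simpa using h1
    · have : i = ⟨d - 1, by omega⟩ := Fin.ext h5
      rw [this]; simpa using h3

lemma card_cone_bounds [Fintype F] (hd4 : 4 ≤ d) (hF : Odd (Fintype.card F)) :
    (Fintype.card F : ℝ) ^ (d - 1) ≤ 2 * (cone F d hd).card ∧
      ((cone F d hd).card : ℝ) ≤ 2 * (Fintype.card F : ℝ) ^ (d - 1) := by
  have h := abs_card_zeros_sub_le (coneForm_nondegenerate F d hd (two_ne_zero_of_odd_card F hF))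
    (mem_cone_iff F d hd)
  have hq : (3 : ℝ) ≤ Fintype.card F := by
    have h1 : 1 < Fintype.card F := Fintype.one_lt_card
    obtain ⟨k, hk⟩ := hF
    have : 3 ≤ Fintype.card F := by omega
    exact_mod_cast this
  set q : ℝ := (Fintype.card F : ℝ)
  have hV : (Fintype.card (Fin d → F) : ℝ) = q ^ d := by
    rw [Fintype.card_fun, Fintype.card_fin]; push_cast; rfl
  have h1 : q ^ d / q = q ^ (d - 1) := by
    rw [div_eq_iff (by positivity), ← pow_succ]; congr 1; omega
  -- The error √N is at most half the main term q^{d-1}, because q ≥ 3 and d ≥ 4 give q^{d-2} ≥ q² ≥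
  -- 4.
  have h2 : √(q ^ d) ≤ q ^ (d - 1) / 2 := by
    rw [Real.sqrt_le_left (by positivity)]
    have h3 : (q ^ (d - 1) / 2) ^ 2 = q ^ d * (q ^ (d - 2) / 4) := by
      rw [div_pow, ← pow_mul, mul_div_assoc', ← pow_add]; norm_num
      congr 2; omega
    rw [h3]
    refine le_mul_of_one_le_right (by positivity) ?_
    have h4 : q ^ 2 ≤ q ^ (d - 2) := pow_le_pow_right₀ (by linarith) (by omega)
    nlinarith
  rw [hV, h1, abs_le] at h
  constructor <;> linarith [h.1, h.2]

end ConeForm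

/-! ### Sufficiency: the averaging estimate in the pentagon -/

section Averaging

open QuadraticMap

variable (F : Type*) [Field F] [Fintype F] (d : ℕ) (hd : 3 ≤ d)

lemma restrictedAverage_eq (f : (Fin d → F) → ℂ) (y : cone F d hd) :
    restrictedAverage F d hd f y = (1 / ((cone F d hd).card : ℂ)) *
      (∑ x, centeredKernel (coneForm F d hd) x y * f x) +
      (1 / ((cone F d hd).card : ℂ)) * ((1 / (Fintype.card F : ℂ)) * ∑ x, f x) := by
  classical
  rw [restrictedAverage, ← mul_add]
  congr 1
  have h : ∑ x ∈ cone F d hd, f (y.1 - x) =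
      ∑ x, (if coneForm F d hd (y - x) = 0 then (1 : ℂ) else 0) * f x := by
    simp_rw [ite_mul, one_mul, zero_mul]
    rw [← Finset.sum_filter]
    refine Finset.sum_bij' (fun x _ => y.1 - x) (fun x _ => y.1 - x) ?_ ?_ ?_ ?_ ?_
    · intro x hx; simpa [mem_cone_iff] using hx
    · intro x hx; simpa [mem_cone_iff] using hx
    · intros; simp
    · intros; simp
    · intros; rfl
  rw [h, Finset.mul_sum, ← Finset.sum_add_distrib]
  refine Finset.sum_congr rfl fun x _ => ?_
  unfold centeredKernel; ring

lemma cone_nonempty : Nonempty (cone F d hd) := ⟨0, by simp [mem_cone_iff]⟩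

lemma norm_restrictedAverage_le (f : (Fin d → F) → ℂ) (y : cone F d hd) :
    ‖restrictedAverage F d hd f y‖ ≤
      (1 / ((cone F d hd).card : ℝ)) * ∑ x ∈ cone F d hd, ‖f (y.1 - x)‖ := by
  rw [restrictedAverage, norm_mul, norm_div, norm_one, Complex.norm_natCast]
  gcongr
  exact norm_sum_le _ _

/-- Uniform bound, with the scaling in `q` that makes the normalized estimate uniform. -/
def ScaledBound (x y : ℝ) : Prop :=
  BilinBound (fun (u : Fin d → F) (v : cone F d hd) => centeredKernel (coneForm F d hd) u v)
    x (1 - y) (3 * (Fintype.card F : ℝ) ^ (((d : ℝ) - 1) * (1 + y) - d * x))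

variable {F d hd}

/-- The exponent of q is affine in (x, y), so Riesz–Thorin produces exactly the required power and
keeps the constant 3. -/
lemma ScaledBound.convex {x₀ y₀ x₁ y₁ : ℝ} (h₀ : ScaledBound F d hd x₀ y₀)
    (h₁ : ScaledBound F d hd x₁ y₁) (hx₀ : 0 < x₀) (hy₀ : y₀ < 1) (hx₁ : 0 < x₁) (hy₁ : y₁ < 1)
    {s : ℝ} (hs0 : 0 ≤ s) (hs1 : s ≤ 1) :
    ScaledBound F d hd ((1 - s) * x₀ + s * x₁) ((1 - s) * y₀ + s * y₁) := by
  have h := BilinBound.interpolate h₀ h₁ hx₀ (by linarith) hx₁ (by linarith) hs0 hs1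
  have e : (1 - s) * (1 - y₀) + s * (1 - y₁) = 1 - ((1 - s) * y₀ + s * y₁) := by ring
  have hq : (0 : ℝ) < Fintype.card F := by exact_mod_cast Fintype.card_pos
  rw [e] at h
  unfold ScaledBound
  convert h using 1
  rw [Real.mul_rpow (by norm_num) (by positivity), Real.mul_rpow (by norm_num) (by positivity),
    mul_mul_mul_comm, ← Real.rpow_add (by norm_num), ← Real.rpow_mul hq.le, ← Real.rpow_mul hq.le,
    ← Real.rpow_add hq, sub_add_cancel, Real.rpow_one]
  congr 2; ring

/-- A scaled bound gives the averaging estimate with an absolute constant. -/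
lemma ScaledBound.meanNorm_le {x y : ℝ} (h : ScaledBound F d hd x y) (hd4 : 4 ≤ d)
    (hF : Odd (Fintype.card F)) (hx : 0 < x) (hx1 : x ≤ 1) (hy : 0 < y) (hy1 : y < 1)
    (f : (Fin d → F) → ℂ) : meanNorm y (restrictedAverage F d hd f) ≤ 14 * meanNorm x f := by
  have := cone_nonempty F d hd
  obtain ⟨hc1, -⟩ := card_cone_bounds F d hd hd4 hF
  set q : ℝ := (Fintype.card F : ℝ) with hq
  set c : ℝ := ((cone F d hd).card : ℝ) with hc
  have hq0 : 0 < q := by rw [hq]; exact_mod_cast Fintype.card_pos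
  have hc0 : 0 < c := by
    have : 0 < q ^ (d - 1) := by positivity
    linarith
  have hV : (Fintype.card (Fin d → F) : ℝ) = q ^ d := by
    rw [Fintype.card_fun, Fintype.card_fin]; push_cast; rfl
  have hcard : (Fintype.card (cone F d hd) : ℝ) = c := by simp [hc]
  have hqd : q ^ (d - 1) * q = q ^ d := by rw [← pow_succ]; congr 1; omega
  have h1 : restrictedAverage F d hd f = fun v : cone F d hd =>
      (1 / ((cone F d hd).card : ℂ)) * (∑ u, centeredKernel (coneForm F d hd) u v * f u) +
      (1 / ((cone F d hd).card : ℂ)) * ((1 / (Fintype.card F : ℂ)) * ∑ u, f u) :=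
    funext fun v => restrictedAverage_eq F d hd f v
  rw [h1]
  refine (meanNorm_add_le hy hy1.le _ _).trans ?_
  have hx' := meanNorm_nonneg x f
  -- Centered part. The constant is 12 = 3 · 4, where 4 bounds 2^{1+y} from q^{d-1} ≤ 2|C|.
  have hA : meanNorm y (fun v : cone F d hd => (1 / ((cone F d hd).card : ℂ)) *
      (∑ u, centeredKernel (coneForm F d hd) u v * f u)) ≤ 12 * meanNorm x f := by
    rw [meanNorm_smul hy, norm_div, norm_one, Complex.norm_natCast, meanNorm_eq_ellNorm hy, hcard,
      ← hc]
    have h2 : ellNorm y (fun v : cone F d hd => ∑ u, centeredKernel (coneForm F d hd) u v * f u) ≤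
        3 * q ^ (((d : ℝ) - 1) * (1 + y) - d * x) * ellNorm x f := by
      refine ellNorm_le_of_forall_dual (mul_nonneg (by positivity) (ellNorm_nonneg _ _)) hy hy1 _
        fun g => ?_
      have h3 := h f g
      rw [Finset.sum_comm] at h3
      simp_rw [Finset.sum_mul]
      exact h3
    have h4 : q ^ (((d : ℝ) - 1) * (1 + y) - d * x) =
        (q ^ (d - 1)) ^ (1 + y) * (q ^ d) ^ (-x) := by
      rw [← Real.rpow_natCast q d, ← Real.rpow_natCast q (d - 1), ← Real.rpow_mul hq0.le,
        ← Real.rpow_mul hq0.le, ← Real.rpow_add hq0, Nat.cast_sub (by omega)]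
      congr 1; push_cast; ring
    have h5 : 1 / c * c ^ (-y) = c ^ (-(1 + y)) := by
      rw [neg_add, Real.rpow_add hc0, Real.rpow_neg_one, one_div]
    have h6 : (q ^ (d - 1)) ^ (1 + y) ≤ 4 * c ^ (1 + y) := by
      calc (q ^ (d - 1)) ^ (1 + y) ≤ (2 * c) ^ (1 + y) := by gcongr
        _ = 2 ^ (1 + y) * c ^ (1 + y) := Real.mul_rpow (by norm_num) hc0.le
        _ ≤ 2 ^ (2 : ℝ) * c ^ (1 + y) := by gcongr <;> linarith
        _ = _ := by norm_num
    rw [← mul_assoc, h5, meanNorm_eq_ellNorm hx, hV]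
    have h7 := ellNorm_nonneg x f
    calc c ^ (-(1 + y)) * ellNorm y _ ≤ c ^ (-(1 + y)) *
          (3 * ((q ^ (d - 1)) ^ (1 + y) * (q ^ d) ^ (-x)) * ellNorm x f) := by
            rw [← h4]; gcongr
      _ ≤ c ^ (-(1 + y)) * (3 * ((4 * c ^ (1 + y)) * (q ^ d) ^ (-x)) * ellNorm x f) := by gcongr
      _ = (c ^ (-(1 + y)) * c ^ (1 + y)) * (12 * ((q ^ d) ^ (-x) * ellNorm x f)) := by ring
      _ = _ := by rw [← Real.rpow_add hc0]; simp
  -- Constant part: q^{d-1}/|C| ≤ 2 times the mean of |f|.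
  have hB : meanNorm y (fun _ : cone F d hd => (1 / ((cone F d hd).card : ℂ)) *
      ((1 / (Fintype.card F : ℂ)) * ∑ u, f u)) ≤ 2 * meanNorm x f := by
    rw [meanNorm_const hy.le, norm_mul, norm_mul, norm_div, norm_div, norm_one,
      Complex.norm_natCast, Complex.norm_natCast, ← hc, ← hq]
    have h2 : ‖∑ u, f u‖ ≤ q ^ d * meanNorm x f := by
      refine (norm_sum_le _ _).trans ?_
      refine le_trans (le_of_eq ?_) (mul_le_mul_of_nonneg_left (meanNorm_anti hx.le hx1 f)
        (by positivity))
      rw [meanNorm_eq_ellNorm one_pos, hV, Real.rpow_neg_one, ellNorm_one,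
        mul_inv_cancel_left₀ (by positivity)]
    calc _ ≤ 1 / c * (1 / q * (q ^ d * meanNorm x f)) := by gcongr
      _ = q ^ (d - 1) / c * meanNorm x f := by rw [← hqd]; field_simp
      _ ≤ 2 * meanNorm x f := by
        gcongr
        rwa [div_le_iff₀ hc0]
  linarith

-- Interpolation between (1, 1) and the two T T* bounds gives the power q^{(d-1)θ/2}. The hypotheses
-- of the implications say that this equals the scale-invariant power, which singles out one θ for
-- each bound.
variable (hd) in
lemma scaledBound_of_param (hF : Odd (Fintype.card F)) {θ : ℝ} (hθ0 : 0 ≤ θ) (hθ1 : θ ≤ 1) :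
    (((d : ℝ) - 1) * (θ / 2) = ((d : ℝ) - 1) * (1 + θ * (1 / 2 - 1 / d)) - d * (1 - θ / 2) →
      ScaledBound F d hd (1 - θ / 2) (θ * (1 / 2 - 1 / d))) ∧
    (((d : ℝ) - 1) * (θ / 2) = ((d : ℝ) - 1) * (1 + θ / 2) - d * (1 - θ * (1 / 2 - 1 / d)) →
      ScaledBound F d hd (1 - θ * (1 / 2 - 1 / d)) (θ / 2)) := by
  obtain ⟨h1, h2⟩ := bilinBound_centeredKernel_cone
    (coneForm_nondegenerate F d hd (two_ne_zero_of_odd_card F hF)) (by omega : 2 ≤ d)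
    (by rw [Fintype.card_fun, Fintype.card_fin]) (mem_cone_iff F d hd)
  have h0 : BilinBound (fun (u : Fin d → F) (v : cone F d hd) =>
      centeredKernel (coneForm F d hd) u v) 1 1 1 :=
    bilinBound_one_one fun u v => norm_centeredKernel_le _ _
  have hq : (0 : ℝ) < Fintype.card F := by exact_mod_cast Fintype.card_pos
  have hM : (1 : ℝ) ^ (1 - θ) * √(3 * (Fintype.card F : ℝ) ^ (d - 1)) ^ θ ≤
      3 * (Fintype.card F : ℝ) ^ (((d : ℝ) - 1) * (θ / 2)) := by
    rw [Real.one_rpow, one_mul, Real.sqrt_eq_rpow, ← Real.rpow_mul (by positivity),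
      Real.mul_rpow (by norm_num) (by positivity), ← Real.rpow_natCast _ (d - 1),
      ← Real.rpow_mul hq.le, Nat.cast_sub (by omega), Nat.cast_one,
      show (1 : ℝ) / 2 * θ = θ / 2 by ring]
    gcongr
    calc (3 : ℝ) ^ (θ / 2) ≤ 3 ^ (1 : ℝ) :=
          Real.rpow_le_rpow_of_exponent_le (by norm_num) (by linarith)
      _ = 3 := Real.rpow_one 3
  have hdpos : (0 : ℝ) < 1 / 2 + 1 / d := by positivity
  have e1 : (1 - θ) * 1 + θ * (1 / 2) = 1 - θ / 2 := by ring
  have e2 : (1 - θ) * 1 + θ * (1 / 2 + 1 / (d : ℝ)) = 1 - θ * (1 / 2 - 1 / d) := by ring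
  constructor
  · intro he
    have h3 := (h0.interpolate h1 one_pos one_pos (by norm_num) hdpos hθ0 hθ1).mono hM
    rw [e1, e2, he] at h3
    exact h3
  · intro he
    have h3 := (h0.interpolate h2 one_pos one_pos hdpos (by norm_num) hθ0 hθ1).mono hM
    rw [e1, e2, he] at h3
    exact h3

variable (hd) in
/-- The vertex `((d-1)/d, 1/(d-2))`. -/
lemma scaledBound_delta_vertex (hd4 : 4 ≤ d) (hF : Odd (Fintype.card F)) :
    ScaledBound F d hd (((d : ℝ) - 1) / d) (1 / ((d : ℝ) - 2)) := by
  have h4 : (4 : ℝ) ≤ d := by exact_mod_cast hd4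
  have h0 : (0 : ℝ) < d := by linarith
  have h2 : (0 : ℝ) < (d : ℝ) - 2 := by linarith
  have e1 : 1 - 2 / ((d : ℝ) - 2) * (1 / 2 - 1 / d) = ((d : ℝ) - 1) / d := by field_simp
  have e2 : 2 / ((d : ℝ) - 2) / 2 = 1 / ((d : ℝ) - 2) := by field_simp
  -- This θ solves the second matching equation, which reduces to θ (d/2 - 1) = 1.
  have h := (scaledBound_of_param hd hF (θ := 2 / ((d : ℝ) - 2)) (by positivity)
    (by rw [div_le_one h2]; linarith)).2
  rw [e1, e2] at h
  exact h (by field_simp; ring)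

variable (hd) in
/-- The vertex `((d²-3d+2)/(d²-2d+2), (d-2)/(d²-2d+2))`. -/
lemma scaledBound_cone_vertex (hd4 : 4 ≤ d) (hF : Odd (Fintype.card F)) :
    ScaledBound F d hd (((d : ℝ) ^ 2 - 3 * d + 2) / ((d : ℝ) ^ 2 - 2 * d + 2))
      (((d : ℝ) - 2) / ((d : ℝ) ^ 2 - 2 * d + 2)) := by
  have h4 : (4 : ℝ) ≤ d := by exact_mod_cast hd4
  have h0 : (0 : ℝ) < d := by linarith
  have hD : (0 : ℝ) < (d : ℝ) ^ 2 - 2 * d + 2 := by nlinarith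
  have hθ : 2 * d / ((d : ℝ) ^ 2 - 2 * d + 2) ≤ 1 := by rw [div_le_one hD]; nlinarith
  have hE : (d : ℝ) ^ 2 - 3 * d + 2 = ((d : ℝ) ^ 2 - 2 * d + 2) - d := by ring
  rw [hE]
  generalize hDd : (d : ℝ) ^ 2 - 2 * d + 2 = D at hD hθ ⊢
  have e1 : 1 - 2 * d / D / 2 = (D - d) / D := by field_simp
  have e2 : 2 * d / D * (1 / 2 - 1 / d) = ((d : ℝ) - 2) / D := by field_simp
  -- This θ solves the first matching equation, which reduces to θ (d/2 - (d-1)/d) = 1.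
  have h := (scaledBound_of_param hd hF (θ := 2 * d / D) (by positivity) hθ).1
  rw [e1, e2] at h
  refine h ?_
  field_simp
  rw [← hDd]; ring

lemma meanNorm_zero_restrictedAverage_le (f : (Fin d → F) → ℂ) :
    meanNorm 0 (restrictedAverage F d hd f) ≤ meanNorm 0 f := by
  have := cone_nonempty F d hd
  have hc : (0 : ℝ) < (cone F d hd).card := by
    have : 0 < Fintype.card (cone F d hd) := Fintype.card_pos
    simpa using this
  refine meanNorm_zero_le (meanNorm_nonneg _ _) fun y =>
    (norm_restrictedAverage_le F d hd f y).trans ?_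
  rw [one_div_mul_eq_div, div_le_iff₀ hc, mul_comm, ← nsmul_eq_mul]
  exact Finset.sum_le_card_nsmul _ _ _ fun x _ => norm_le_meanNorm_zero f _

/-- Interpolation with the trivial `L^∞` bound, by Jensen's inequality. -/
lemma meanNorm_div_le_of_one_le {x y k K : ℝ} (hx : 0 < x) (hy : 0 < y) (hk : 1 ≤ k) (hK : 1 ≤ K)
    (h : ∀ f : (Fin d → F) → ℂ, meanNorm y (restrictedAverage F d hd f) ≤ K * meanNorm x f)
    (f : (Fin d → F) → ℂ) :
    meanNorm (y / k) (restrictedAverage F d hd f) ≤ K * meanNorm (x / k) f := by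
  have := cone_nonempty F d hd
  have hk0 : 0 < k := by linarith
  have hc : ((cone F d hd).card : ℝ) ≠ 0 := by
    have : 0 < Fintype.card (cone F d hd) := Fintype.card_pos
    have : 0 < (cone F d hd).card := by simpa using this
    positivity
  -- Averaging is positive, so Jensen gives |A f|^k ≤ A(|f|^k) pointwise; the estimate for |f|^k and
  -- K ≤ K^k then finish.
  have h1 := h (fun u => ((‖f u‖ ^ k : ℝ) : ℂ))
  rw [meanNorm_rpow hx hk0] at h1
  have h2 : meanNorm y (fun v => ((‖restrictedAverage F d hd f v‖ ^ k : ℝ) : ℂ)) ≤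
      meanNorm y (restrictedAverage F d hd (fun u => ((‖f u‖ ^ k : ℝ) : ℂ))) := by
    refine meanNorm_mono hy.le fun v => ?_
    have h3 : restrictedAverage F d hd (fun u => ((‖f u‖ ^ k : ℝ) : ℂ)) v =
        ((∑ u ∈ cone F d hd, (1 / ((cone F d hd).card : ℝ)) * ‖f (v.1 - u)‖ ^ k : ℝ) : ℂ) := by
      rw [restrictedAverage, ← Finset.mul_sum]; push_cast; rfl
    rw [h3, Complex.norm_real, Complex.norm_real, Real.norm_of_nonneg (by positivity),
      Real.norm_of_nonneg (by positivity)]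
    refine (Real.rpow_le_rpow (norm_nonneg _) (norm_restrictedAverage_le F d hd f v)
      hk0.le).trans ?_
    rw [Finset.mul_sum]
    exact Real.rpow_arith_mean_le_arith_mean_rpow _ (fun _ => 1 / ((cone F d hd).card : ℝ)) _
      (fun _ _ => by positivity) (by simp [hc]) (fun _ _ => norm_nonneg _) hk
  rw [meanNorm_rpow hy hk0] at h2
  have h4 := meanNorm_nonneg (x / k) f
  rw [← Real.rpow_le_rpow_iff (meanNorm_nonneg _ _) (by positivity) hk0,
    Real.mul_rpow (by positivity) h4]
  refine h2.trans (h1.trans ?_)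
  gcongr
  exact Real.self_le_rpow_of_one_le hK hk

variable (hd) in
/-- The averaging estimate in the whole pentagon. -/
theorem meanNorm_restrictedAverage_le (hd4 : 4 ≤ d) (hF : Odd (Fintype.card F)) {x y : ℝ}
    (hx0 : 0 ≤ x) (hx1 : x ≤ ((d : ℝ) - 1) / d) (hxy : x ≤ ((d : ℝ) - 1) * y)
    (hxy' : d * x ≤ ((d : ℝ) - 2) * (1 + y)) (f : (Fin d → F) → ℂ) :
    meanNorm y (restrictedAverage F d hd f) ≤ 14 * meanNorm x f := by
  have := cone_nonempty F d hd
  have h4 : (4 : ℝ) ≤ d := by exact_mod_cast hd4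
  have h0 : (0 : ℝ) < d := by linarith
  have hd1 : (0 : ℝ) < (d : ℝ) - 1 := by linarith
  have hd2 : (0 : ℝ) < (d : ℝ) - 2 := by linarith
  have hD : (0 : ℝ) < (d : ℝ) ^ 2 - 2 * d + 2 := by nlinarith
  have hE : (0 : ℝ) < (d : ℝ) ^ 2 - 3 * d + 2 := by nlinarith
  have hS3 := scaledBound_cone_vertex hd hd4 hF
  have hS2 := scaledBound_delta_vertex hd hd4 hF
  set D : ℝ := (d : ℝ) ^ 2 - 2 * d + 2 with hD_def
  set x₃ : ℝ := ((d : ℝ) ^ 2 - 3 * d + 2) / D with hx₃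
  set y₃ : ℝ := ((d : ℝ) - 2) / D with hy₃
  have hx₃0 : 0 < x₃ := by positivity
  have hx₃1 : x₃ ≤ 1 := by rw [hx₃, div_le_one hD]; linarith
  have hy₃0 : 0 < y₃ := by positivity
  have hy₃1 : y₃ < 1 := by rw [hy₃, div_lt_one hD]; nlinarith
  have hxy₃ : x₃ = ((d : ℝ) - 1) * y₃ := by rw [hx₃, hy₃]; field_simp; ring
  have hxy₃' : d * x₃ = ((d : ℝ) - 2) * (1 + y₃) := by rw [hx₃, hy₃]; field_simp; ring
  rcases hx0.eq_or_lt with rfl | hx0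
  · have hy : 0 ≤ y := by
      by_contra hy
      push Not at hy
      nlinarith
    have h1 := meanNorm_anti le_rfl hy (restrictedAverage F d hd f)
    have h2 := meanNorm_zero_restrictedAverage_le (hd := hd) f
    have h3 := meanNorm_nonneg 0 f
    linarith
  rcases le_total x x₃ with h | h
  -- Dividing the vertex by k = x₃/x lands on the ray at (x, x/(d-1)), the lower edge x = (d-1) y;
  -- larger y follows by nesting.
  · have h1 := meanNorm_div_le_of_one_le (hd := hd) hx₃0 hy₃0 (k := x₃ / x) ((one_le_div hx0).2 h)
      (by norm_num) (fun f => hS3.meanNorm_le hd4 hF hx₃0 hx₃1 hy₃0 hy₃1 f) f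
    have e1 : x₃ / (x₃ / x) = x := by field_simp
    rw [e1] at h1
    refine (meanNorm_anti (by positivity) ?_ _).trans h1
    have e2 : y₃ / (x₃ / x) = x / ((d : ℝ) - 1) := by rw [hxy₃]; field_simp
    rw [e2, div_le_iff₀ hd1]; linarith
  · set x₂ : ℝ := ((d : ℝ) - 1) / d with hx₂
    set y₂ : ℝ := 1 / ((d : ℝ) - 2) with hy₂
    have hx₂0 : 0 < x₂ := by positivity
    have hx₂1 : x₂ ≤ 1 := by rw [hx₂, div_le_one h0]; linarith
    have hy₂0 : 0 < y₂ := by positivity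
    have hy₂1 : y₂ < 1 := by rw [hy₂, div_lt_one hd2]; linarith
    have hxy₂' : d * x₂ = ((d : ℝ) - 2) * (1 + y₂) := by rw [hx₂, hy₂]; field_simp; ring
    have hlt : x₃ < x₂ := by
      rw [hx₃, hx₂, div_lt_div_iff₀ hD h0, hD_def]
      nlinarith
    -- Both vertices lie on the line d x = (d-2)(1+y), so the interpolated point with abscissa x is
    -- the lowest admissible one.
    set s : ℝ := (x - x₃) / (x₂ - x₃) with hs
    have hs0 : 0 ≤ s := div_nonneg (by linarith) (by linarith)
    have hs1 : s ≤ 1 := by rw [hs, div_le_one (by linarith)]; linarith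
    have hxs : (1 - s) * x₃ + s * x₂ = x := by
      have : s * (x₂ - x₃) = x - x₃ := by rw [hs, div_mul_cancel₀]; linarith
      linarith
    have h1 := hS3.convex hS2 hx₃0 hy₃1 hx₂0 hy₂1 hs0 hs1
    rw [hxs] at h1
    have hs1' : 0 ≤ 1 - s := by linarith
    have hy0 : 0 < (1 - s) * y₃ + s * y₂ := by
      rcases hs0.eq_or_lt with h | h
      · rw [← h]; simpa using hy₃0
      · have := mul_nonneg hs1' hy₃0.le
        have := mul_pos h hy₂0
        linarith
    have hy1 : (1 - s) * y₃ + s * y₂ < 1 := by nlinarith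
    have hyy : (1 - s) * y₃ + s * y₂ ≤ y := by
      have : ((d : ℝ) - 2) * (1 + ((1 - s) * y₃ + s * y₂)) = d * x := by
        rw [← hxs]; linear_combination (-(1 - s)) * hxy₃' - s * hxy₂'
      by_contra hcon
      push Not at hcon
      nlinarith
    exact (meanNorm_anti hy0.le hyy _).trans
      (h1.meanNorm_le hd4 hF hx0 (hx1.trans hx₂1) hy0 hy1 f)

end Averaging

/-! ### Necessity: three test functions -/

section Necessity

variable {X : Type*} [Fintype X]

lemma meanNorm_indicator [DecidableEq X] {E : Finset X} (hE : E.Nonempty) {a : ℝ} (ha : 0 ≤ a) (c : ℂ) :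
    meanNorm a (fun u => if u ∈ E then c else 0) =
      ((E.card : ℝ) / Fintype.card X) ^ a * ‖c‖ := by
  rcases ha.eq_or_lt with rfl | ha
  · rw [Real.rpow_zero, one_mul]
    obtain ⟨u, hu⟩ := hE
    refine le_antisymm (meanNorm_zero_le (norm_nonneg _) fun v => ?_) ?_
    · split_ifs <;> simp
    · simpa [hu] using norm_le_meanNorm_zero (fun u => if u ∈ E then c else 0) u
  · have h1 : ∀ u, ‖if u ∈ E then c else 0‖ ^ (1 / a) = if u ∈ E then ‖c‖ ^ (1 / a) else 0 := by
      intro u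
      split_ifs
      · rfl
      · rw [norm_zero, Real.zero_rpow (by positivity)]
    rw [meanNorm, if_neg ha.ne']
    simp_rw [h1]
    rw [Finset.sum_ite_mem, Finset.univ_inter, Finset.sum_const, nsmul_eq_mul, ← mul_assoc,
      Real.mul_rpow (by positivity) (by positivity), ← Real.rpow_mul (norm_nonneg _),
      one_div_mul_cancel ha.ne', Real.rpow_one, one_div_mul_eq_div]

lemma le_meanNorm_of_le_on {E : Finset X} (hE : E.Nonempty) {a c : ℝ} (ha : 0 ≤ a) (hc : 0 ≤ c)
    {f : X → ℂ} (h : ∀ u ∈ E, c ≤ ‖f u‖) :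
    ((E.card : ℝ) / Fintype.card X) ^ a * c ≤ meanNorm a f := by
  classical
  have h1 := meanNorm_indicator hE ha (c : ℂ)
  rw [Complex.norm_real, Real.norm_of_nonneg hc] at h1
  rw [← h1]
  refine meanNorm_mono ha fun u => ?_
  split_ifs with hu
  · rw [Complex.norm_real, Real.norm_of_nonneg hc]; exact h u hu
  · simp

lemma exponent_nonpos_of_unbounded {α M : ℝ}
    (h : ∀ n : ℕ, ∃ q : ℝ, n < q ∧ q ^ α ≤ M) : α ≤ 0 := by
  by_contra! hα
  obtain ⟨R, hR⟩ := Filter.eventually_atTop.1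
    ((tendsto_rpow_atTop hα).eventually (Filter.eventually_gt_atTop M))
  obtain ⟨q, hq, hqM⟩ := h ⌈R⌉₊
  exact absurd hqM (not_le.2 (hR q ((Nat.le_ceil R).trans hq.le)))

variable {F : Type*} [Field F] [Fintype F] {d : ℕ} {hd : 3 ≤ d}

/-- Testing the estimate on the point mass at the origin, on the cone, and on a subspace. -/
lemma necessary_powers (hd4 : 4 ≤ d) (hde : Even d) (hF : Odd (Fintype.card F))
    (hH : ContainsHalfDimSubspace F d hd) {x y K : ℝ} (hx0 : 0 ≤ x) (hx1 : x ≤ 1) (hy0 : 0 ≤ y)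
    (hy1 : y ≤ 1) (h : ∀ f : (Fin d → F) → ℂ,
      meanNorm y (restrictedAverage F d hd f) ≤ K * meanNorm x f) :
    (Fintype.card F : ℝ) ^ (d * x - (d - 1)) ≤ 4 * K ∧
    (Fintype.card F : ℝ) ^ (x - (d - 1) * y) ≤ 4 * K ∧
    (Fintype.card F : ℝ) ^ (d / 2 * x - (d / 2 - 1) * (1 + y)) ≤ 4 * K := by
  classical
  have := cone_nonempty F d hd
  obtain ⟨-, hc2⟩ := card_cone_bounds F d hd hd4 hF
  have hq0 : (0 : ℝ) < Fintype.card F := by exact_mod_cast Fintype.card_pos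
  have hV : (Fintype.card (Fin d → F) : ℝ) = (Fintype.card F : ℝ) ^ (d : ℝ) := by
    rw [Fintype.card_fun, Fintype.card_fin, Real.rpow_natCast]; push_cast; rfl
  have hc0 : 0 < (cone F d hd).card := by
    have : 0 < Fintype.card (cone F d hd) := Fintype.card_pos
    simpa using this
  have hcard : (Fintype.card (cone F d hd) : ℝ) = (cone F d hd).card := by simp
  rw [← Real.rpow_natCast, Nat.cast_sub (by omega), Nat.cast_one] at hc2
  set q : ℝ := (Fintype.card F : ℝ) with hq
  have hc0' : (0 : ℝ) < (cone F d hd).card := by exact_mod_cast hc0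
  set c : ℝ := ((cone F d hd).card : ℝ) with hc
  have hK : 0 ≤ K := by
    have h1 := h (fun _ => 1)
    rw [meanNorm_const hx0, norm_one, mul_one] at h1
    exact (meanNorm_nonneg _ _).trans h1
  refine ⟨?_, ?_, ?_⟩
  -- Point mass: its average is the constant 1/|C| on the cone.
  · have h1 := h (fun u => if u ∈ ({0} : Finset (Fin d → F)) then 1 else 0)
    rw [meanNorm_indicator (by simp) hx0] at h1
    have h2 : restrictedAverage F d hd (fun u => if u ∈ ({0} : Finset (Fin d → F)) then 1 else 0) =
        fun _ => 1 / ((cone F d hd).card : ℂ) := by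
      funext v
      have : ∑ u ∈ cone F d hd, (if v.1 - u ∈ ({0} : Finset (Fin d → F)) then (1 : ℂ) else 0) =
          1 := by
        rw [Finset.sum_eq_single v.1]
        · simp
        · intro u _ hu
          simp [sub_eq_zero, Ne.symm hu]
        · intro hv; exact absurd v.2 hv
      rw [restrictedAverage, this, mul_one]
    rw [h2, meanNorm_const hy0, norm_div, norm_one, Complex.norm_natCast, ← hc, mul_one,
      hV, Finset.card_singleton, Nat.cast_one, one_div (q ^ (d : ℝ)), ← Real.rpow_neg hq0.le,
      ← Real.rpow_mul hq0.le, div_le_iff₀ hc0'] at h1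
    have h3 : (1 : ℝ) ≤ K * q ^ (-(d : ℝ) * x) * (2 * q ^ ((d : ℝ) - 1)) :=
      h1.trans (by gcongr)
    have h4 : q ^ (d * x - (d - 1)) * (K * q ^ (-(d : ℝ) * x) * (2 * q ^ ((d : ℝ) - 1))) =
        2 * K := by
      have : q ^ (d * x - (d - 1)) * q ^ (-(d : ℝ) * x) * q ^ ((d : ℝ) - 1) = 1 := by
        rw [← Real.rpow_add hq0, ← Real.rpow_add hq0, ← Real.rpow_zero q]; congr 1; ring
      linear_combination 2 * K * this
    calc _ ≤ _ := le_mul_of_one_le_right (by positivity) h3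
      _ = 2 * K := h4
      _ ≤ 4 * K := by linarith
  -- Indicator of C: since C = -C, its average equals 1 at the origin, and that single point
  -- suffices for the lower bound.
  · have h1 := h (fun u => if u ∈ cone F d hd then 1 else 0)
    rw [meanNorm_indicator (Finset.card_pos.1 hc0) hx0, norm_one, mul_one, hV, ← hc] at h1
    have h2 := le_meanNorm_of_le_on (E := {(⟨0, by simp [mem_cone_iff]⟩ : cone F d hd)})
      (by simp) hy0 zero_le_one
      (f := restrictedAverage F d hd (fun u => if u ∈ cone F d hd then 1 else 0)) (by
        intro v hv
        rw [Finset.mem_singleton] at hv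
        subst hv
        have : ∑ u ∈ cone F d hd, (if 0 - u ∈ cone F d hd then (1 : ℂ) else 0) =
            (cone F d hd).card := by
          rw [Finset.sum_congr rfl (g := fun _ => (1 : ℂ))]
          · simp
          · intro u hu
            rw [if_pos]
            rw [mem_cone_iff] at hu ⊢
            simpa using hu
        rw [restrictedAverage, this, one_div_mul_cancel (by exact_mod_cast hc0.ne'), norm_one])
    rw [Finset.card_singleton, mul_one, hcard, Nat.cast_one] at h2
    have h3 := h2.trans h1
    have h4 : (c / q ^ (d : ℝ)) ^ x ≤ 2 * q ^ (-x) := by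
      calc (c / q ^ (d : ℝ)) ^ x ≤ (2 * q ^ ((d : ℝ) - 1) / q ^ (d : ℝ)) ^ x := by gcongr
        _ = (2 * q ^ (-1 : ℝ)) ^ x := by
            rw [mul_div_assoc, ← Real.rpow_sub hq0]; congr 3; ring
        _ = 2 ^ x * q ^ (-x) := by
            rw [Real.mul_rpow (by norm_num) (by positivity), ← Real.rpow_mul hq0.le]; congr 2; ring
        _ ≤ 2 ^ (1 : ℝ) * q ^ (-x) := by gcongr; norm_num
        _ = _ := by rw [Real.rpow_one]
    have h5 : c ^ y ≤ 2 * q ^ (((d : ℝ) - 1) * y) := by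
      calc c ^ y ≤ (2 * q ^ ((d : ℝ) - 1)) ^ y := by gcongr
        _ = 2 ^ y * q ^ (((d : ℝ) - 1) * y) := by
            rw [Real.mul_rpow (by norm_num) (by positivity), ← Real.rpow_mul hq0.le]
        _ ≤ 2 ^ (1 : ℝ) * q ^ (((d : ℝ) - 1) * y) := by gcongr; norm_num
        _ = _ := by rw [Real.rpow_one]
    rw [Real.div_rpow zero_le_one hc0'.le, Real.one_rpow, div_le_iff₀ (by positivity)] at h3
    have h6 : (1 : ℝ) ≤ K * (2 * q ^ (-x)) * (2 * q ^ (((d : ℝ) - 1) * y)) :=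
      h3.trans (by gcongr)
    have h7 : q ^ (x - (d - 1) * y) * (K * (2 * q ^ (-x)) * (2 * q ^ (((d : ℝ) - 1) * y))) =
        4 * K := by
      have : q ^ (x - (d - 1) * y) * q ^ (-x) * q ^ (((d : ℝ) - 1) * y) = 1 := by
        rw [← Real.rpow_add hq0, ← Real.rpow_add hq0, ← Real.rpow_zero q]; congr 1; ring
      linear_combination 4 * K * this
    exact (le_mul_of_one_le_right (by positivity) h6).trans h7.le
  · obtain ⟨H, hHd, hHC⟩ := hH
    -- Indicator of H: since H ⊆ C is closed under subtraction, the average equals |H|/|C| at every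
    -- point of H.
    let E : Finset (Fin d → F) := {u | u ∈ H}
    have hEH : ∀ u, u ∈ E ↔ u ∈ H := fun u => by simp [E]
    have hEC : E ⊆ cone F d hd := fun u hu => by
      have := hHC ((hEH u).1 hu)
      simpa using this
    have hd2 : ((d / 2 : ℕ) : ℝ) = (d : ℝ) / 2 := by
      rw [Nat.cast_div hde.two_dvd (by norm_num)]; norm_num
    have hEc : (E.card : ℝ) = q ^ ((d : ℝ) / 2) := by
      have h1 : E.card = Fintype.card H := by
        rw [← Fintype.card_coe]
        exact Fintype.card_congr (Equiv.subtypeEquivRight hEH)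
      rw [h1, Module.card_eq_pow_finrank (K := F), hHd, ← hd2, Real.rpow_natCast]
      push_cast; rfl
    have hE0 : E.Nonempty := ⟨0, by simp [hEH]⟩
    have h1 := h (fun u => if u ∈ E then 1 else 0)
    rw [meanNorm_indicator hE0 hx0, norm_one, mul_one, hV, hEc, ← Real.rpow_sub hq0,
      ← Real.rpow_mul hq0.le] at h1
    let E' : Finset (cone F d hd) := {v | v.1 ∈ E}
    have hE'c : E'.card = E.card := by
      refine Finset.card_bij (fun v _ => v.1) ?_ ?_ ?_
      · intro v hv; simpa [E'] using hv
      · intro v _ w _ hvw; exact Subtype.ext hvw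
      · intro u hu; exact ⟨⟨u, hEC hu⟩, by simpa [E'] using hu, rfl⟩
    have h2 := le_meanNorm_of_le_on (E := E')
      (Finset.card_pos.1 (by rw [hE'c]; exact hE0.card_pos)) hy0
      (c := q ^ ((d : ℝ) / 2) / c) (by positivity)
      (f := restrictedAverage F d hd (fun u => if u ∈ E then 1 else 0)) (by
        intro v hv
        have hv : v.1 ∈ H := by simpa [E', hEH] using hv
        have : ∑ u ∈ cone F d hd, (if v.1 - u ∈ E then (1 : ℂ) else 0) = (E.card : ℂ) := by
          rw [← Finset.sum_filter, Finset.sum_const, nsmul_eq_mul, mul_one]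
          congr 2
          ext u
          simp only [Finset.mem_filter, hEH]
          constructor
          · rintro ⟨-, hu⟩
            simpa using H.sub_mem hv hu
          · intro hu
            exact ⟨hEC ((hEH u).2 hu), H.sub_mem hv hu⟩
        rw [restrictedAverage, this, norm_mul, norm_div, norm_one, Complex.norm_natCast,
          Complex.norm_natCast, hEc, ← hc, one_div_mul_eq_div])
    rw [hE'c, hEc, hcard] at h2
    have h3 := h2.trans h1
    have h4 : (q ^ ((d : ℝ) / 2) / c) ^ y * (q ^ ((d : ℝ) / 2) / c) =
        q ^ ((d : ℝ) / 2 * (1 + y)) / c ^ (1 + y) := by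
      have : 0 < q ^ ((d : ℝ) / 2) / c := by positivity
      rw [Real.rpow_mul hq0.le, ← Real.div_rpow (by positivity) hc0'.le, add_comm 1 y,
        Real.rpow_add this, Real.rpow_one]
    rw [h4, div_le_iff₀ (by positivity)] at h3
    have h5 : c ^ (1 + y) ≤ 4 * q ^ (((d : ℝ) - 1) * (1 + y)) := by
      calc c ^ (1 + y) ≤ (2 * q ^ ((d : ℝ) - 1)) ^ (1 + y) := by gcongr
        _ = 2 ^ (1 + y) * q ^ (((d : ℝ) - 1) * (1 + y)) := by
            rw [Real.mul_rpow (by norm_num) (by positivity), ← Real.rpow_mul hq0.le]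
        _ ≤ 2 ^ (2 : ℝ) * q ^ (((d : ℝ) - 1) * (1 + y)) := by gcongr <;> linarith
        _ = _ := by norm_num
    have h6 : q ^ ((d : ℝ) / 2 * (1 + y)) ≤
        K * q ^ (((d : ℝ) / 2 - d) * x) * (4 * q ^ (((d : ℝ) - 1) * (1 + y))) :=
      h3.trans (by gcongr)
    have h7 : q ^ ((d : ℝ) / 2 * x - (d / 2 - 1) * (1 + y)) =
        q ^ ((d : ℝ) / 2 * (1 + y)) * q ^ ((d : ℝ) / 2 * x - ((d : ℝ) - 1) * (1 + y)) := by
      rw [← Real.rpow_add hq0]; congr 1; ring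
    have h8 : q ^ (((d : ℝ) / 2 - d) * x) * q ^ (((d : ℝ) - 1) * (1 + y)) *
        q ^ ((d : ℝ) / 2 * x - ((d : ℝ) - 1) * (1 + y)) = 1 := by
      rw [← Real.rpow_add hq0, ← Real.rpow_add hq0, ← Real.rpow_zero q]; congr 1; ring
    rw [h7]
    calc _ ≤ K * q ^ (((d : ℝ) / 2 - d) * x) * (4 * q ^ (((d : ℝ) - 1) * (1 + y))) *
          q ^ ((d : ℝ) / 2 * x - ((d : ℝ) - 1) * (1 + y)) := by gcongr
      _ = 4 * K := by linear_combination 4 * K * h8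

end Necessity

/-! ### Half-dimensional subspaces of the cone -/

section Subspace

lemma sum_range_two_mul_eq_zero {M : Type*} [AddCommMonoid M] (g : ℕ → M) (m : ℕ)
    (h : ∀ k < m, g (2 * k) + g (2 * k + 1) = 0) : ∑ j ∈ Finset.range (2 * m), g j = 0 := by
  induction m with
  | zero => simp
  | succ m ih =>
    rw [show 2 * (m + 1) = 2 * m + 1 + 1 by ring, Finset.sum_range_succ, Finset.sum_range_succ,
      ih fun k hk => h k (by omega), zero_add]
    exact h m (by omega)

/-- If `-1` is a square, the cone contains a subspace of half the dimension. -/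
lemma containsHalfDimSubspace_of_isSquare_neg_one {F : Type*} [Field F] [Fintype F] {d : ℕ}
    (hd : 3 ≤ d) (hde : Even d) (hi : IsSquare (-1 : F)) : ContainsHalfDimSubspace F d hd := by
  obtain ⟨i, hi⟩ := hi
  obtain ⟨m, hm⟩ := hde
  -- With i² = -1, the map is z ↦ (z₀, i z₀, z₁, i z₁, …, z_{d/2-1}, 0): the squares cancel in
  -- pairs, and the final zero kills the product of the last two coordinates.
  let L : (Fin (d / 2) → F) →ₗ[F] (Fin d → F) := LinearMap.pi fun j =>
    (if j.1 = d - 1 then 0 else if Even j.1 then 1 else i) •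
      LinearMap.proj (⟨j.1 / 2, by have := j.2; omega⟩ : Fin (d / 2))
  have hL : ∀ z j, L z j = (if j.1 = d - 1 then 0 else if Even j.1 then 1 else i) *
      z ⟨j.1 / 2, by have := j.2; omega⟩ := fun _ _ => rfl
  have hinj : Function.Injective L := by
    intro z w hzw
    funext k
    have hk := k.2
    have h1 := congrFun hzw ⟨2 * k.1, by omega⟩
    rw [hL, hL] at h1
    have h2 : ¬ 2 * k.1 = d - 1 := by omega
    simpa [h2] using h1
  refine ⟨LinearMap.range L, ?_, ?_⟩
  · rw [LinearMap.finrank_range_of_inj hinj]; simp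
  · rintro _ ⟨z, rfl⟩
    rw [Finset.mem_coe, mem_cone_iff, coneForm_apply, hL z ⟨d - 1, by omega⟩]
    simp only [if_true, zero_mul, mul_zero, sub_zero]
    let g : ℕ → F := fun j => if hj : j < d then L z ⟨j, hj⟩ ^ 2 else 0
    have h1 : ∑ j : Fin (d - 2), L z (Fin.castLE (Nat.sub_le d 2) j) ^ 2 =
        ∑ j : Fin (d - 2), g j := by
      refine Finset.sum_congr rfl fun j _ => ?_
      have : j.1 < d := by have := j.2; omega
      simp only [g, dif_pos this]
      rfl
    rw [h1, Fin.sum_univ_eq_sum_range g (d - 2), show d - 2 = 2 * (m - 1) by omega]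
    refine sum_range_two_mul_eq_zero g _ fun k hk => ?_
    have h2 : 2 * k < d := by omega
    have h3 : 2 * k + 1 < d := by omega
    have h4 : ¬ 2 * k = d - 1 := by omega
    have h5 : ¬ 2 * k + 1 = d - 1 := by omega
    have h6 : (2 * k + 1) / 2 = k := by omega
    simp only [g, dif_pos h2, dif_pos h3, hL, h4, h5, h6, if_false]
    simp [mul_pow, pow_two i, ← hi]

/-- Arbitrarily large odd fields over which the cone contains a half-dimensional subspace. -/
lemma exists_field_containsHalfDimSubspace {d : ℕ} (hd : 3 ≤ d) (hde : Even d) (n : ℕ) :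
    ∃ (F : Type u) (_ : Field F) (_ : Fintype F), n < Fintype.card F ∧ Odd (Fintype.card F) ∧
      ContainsHalfDimSubspace F d hd := by
  obtain ⟨p, hp, hnp, hp4⟩ := Nat.exists_prime_gt_modEq_one (k := 4) n (by norm_num)
  have : Fact p.Prime := ⟨hp⟩
  have hmod : p % 4 = 1 := hp4
  have hcard : Fintype.card (ULift.{u} (ZMod p)) = p := by simp [ZMod.card]
  refine ⟨ULift.{u} (ZMod p), inferInstance, inferInstance, by rw [hcard]; exact hnp, ?_, ?_⟩
  · rw [hcard, Nat.odd_iff]; omega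
  · refine containsHalfDimSubspace_of_isSquare_neg_one hd hde ?_
    obtain ⟨a, ha⟩ := ZMod.exists_sq_eq_neg_one_iff.2 (by omega : p % 4 ≠ 3)
    exact ⟨ULift.up a, ULift.ext _ _ ha⟩

end Subspace

/-! ### The convex hull as an intersection of half-planes -/

section Pentagon

lemma Convex.mem_of_vertical {T : Set (ℝ × ℝ)} (hT : Convex ℝ T) {x y₀ y₁ y : ℝ}
    (h₀ : (x, y₀) ∈ T) (h₁ : (x, y₁) ∈ T) (hy₀ : y₀ ≤ y) (hy₁ : y ≤ y₁) : (x, y) ∈ T := by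
  refine hT.segment_subset h₀ h₁ ?_
  rw [← Prod.image_mk_segment_right, segment_eq_Icc (hy₀.trans hy₁)]
  exact ⟨y, ⟨hy₀, hy₁⟩, rfl⟩

lemma Convex.mem_of_param {T : Set (ℝ × ℝ)} (hT : Convex ℝ T) {x₀ y₀ x₁ y₁ : ℝ}
    (h₀ : (x₀, y₀) ∈ T) (h₁ : (x₁, y₁) ∈ T) {s : ℝ} (hs0 : 0 ≤ s) (hs1 : s ≤ 1) :
    ((1 - s) * x₀ + s * x₁, (1 - s) * y₀ + s * y₁) ∈ T := by
  simpa using hT h₀ h₁ (sub_nonneg.2 hs1) hs0 (by ring)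

/-- The pentagon as an intersection of half-planes. -/
lemma mem_convexHull_pentagon_iff {d : ℝ} (hd : 4 ≤ d) (x y : ℝ) :
    (x, y) ∈ convexHull ℝ
      ({((0 : ℝ), (0 : ℝ)), (0, 1), ((d - 1) / d, 1), ((d - 1) / d, 1 / (d - 2)),
        ((d ^ 2 - 3 * d + 2) / (d ^ 2 - 2 * d + 2), (d - 2) / (d ^ 2 - 2 * d + 2))} :
          Set (ℝ × ℝ)) ↔
    0 ≤ x ∧ x ≤ (d - 1) / d ∧ y ≤ 1 ∧ x ≤ (d - 1) * y ∧ d * x ≤ (d - 2) * (1 + y) := by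
  have h0 : 0 < d := by linarith
  have hd1 : 0 < d - 1 := by linarith
  have hd2 : 0 < d - 2 := by linarith
  have hD : 0 < d ^ 2 - 2 * d + 2 := by nlinarith
  have hE : 0 < d ^ 2 - 3 * d + 2 := by nlinarith
  have hD' := hD.ne'
  set x₂ := (d - 1) / d with hx₂
  set y₂ := 1 / (d - 2) with hy₂
  set x₃ := (d ^ 2 - 3 * d + 2) / (d ^ 2 - 2 * d + 2) with hx₃
  set y₃ := (d - 2) / (d ^ 2 - 2 * d + 2) with hy₃
  have hx₂0 : 0 < x₂ := by positivity
  have hx₂1 : d * x₂ = d - 1 := by rw [hx₂]; field_simp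
  have hy₂0 : 0 < y₂ := by positivity
  have hy₂1 : y₂ ≤ 1 := by rw [hy₂, div_le_one hd2]; linarith
  have hx₃0 : 0 < x₃ := by positivity
  have hy₃0 : 0 < y₃ := by positivity
  have hy₃1 : y₃ ≤ 1 := by rw [hy₃, div_le_one hD]; nlinarith
  have hlt : x₃ < x₂ := by
    rw [hx₃, hx₂, div_lt_div_iff₀ hD h0]; nlinarith
  have hxy₃ : x₃ = (d - 1) * y₃ := by rw [hx₃, hy₃]; field_simp; ring
  have hxy₃' : d * x₃ = (d - 2) * (1 + y₃) := by rw [hx₃, hy₃]; field_simp; ring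
  have hxy₂' : d * x₂ = (d - 2) * (1 + y₂) := by rw [hx₂, hy₂]; field_simp; ring
  have hxy₂ : x₂ ≤ (d - 1) * y₂ := by
    rw [hx₂, hy₂, mul_one_div]
    exact div_le_div_of_nonneg_left hd1.le hd2 (by linarith)
  constructor
  · intro h
    let S : Set (ℝ × ℝ) := {z | 0 ≤ z.1 ∧ z.1 ≤ x₂ ∧ z.2 ≤ 1 ∧ z.1 ≤ (d - 1) * z.2 ∧
      d * z.1 ≤ (d - 2) * (1 + z.2)}
    have hS : Convex ℝ S := by
      rintro ⟨u, v⟩ ⟨a1, a2, a3, a4, a5⟩ ⟨u', v'⟩ ⟨b1, b2, b3, b4, b5⟩ a b ha hb hab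
      obtain rfl : b = 1 - a := by linarith
      simp only at a1 a2 a3 a4 a5 b1 b2 b3 b4 b5
      simp only [S, Set.mem_ofPred_eq, Prod.smul_mk, Prod.mk_add_mk, smul_eq_mul]
      refine ⟨by positivity, ?_, ?_, ?_, ?_⟩
      · linarith [mul_le_mul_of_nonneg_left a2 ha, mul_le_mul_of_nonneg_left b2 hb]
      · linarith [mul_le_mul_of_nonneg_left a3 ha, mul_le_mul_of_nonneg_left b3 hb]
      · linarith [mul_le_mul_of_nonneg_left a4 ha, mul_le_mul_of_nonneg_left b4 hb]
      · linarith [mul_le_mul_of_nonneg_left a5 ha, mul_le_mul_of_nonneg_left b5 hb]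
    refine convexHull_min ?_ hS h
    rintro z (rfl | rfl | rfl | rfl | rfl)
    · exact ⟨le_rfl, hx₂0.le, zero_le_one, by simp, by simp; linarith⟩
    · exact ⟨le_rfl, hx₂0.le, le_rfl, by simp; linarith, by simp; linarith⟩
    · refine ⟨hx₂0.le, le_rfl, le_rfl, ?_, ?_⟩
      · simp only; nlinarith
      · simp only; linarith
    · exact ⟨hx₂0.le, le_rfl, hy₂1, hxy₂, hxy₂'.le⟩
    · exact ⟨hx₃0.le, hlt.le, hy₃1, hxy₃.le, hxy₃'.le⟩
  · rintro ⟨hx0, hx1, hy1, hxy, hxy'⟩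
    set T := convexHull ℝ ({((0 : ℝ), (0 : ℝ)), (0, 1), (x₂, 1), (x₂, y₂), (x₃, y₃)} :
      Set (ℝ × ℝ))
    have hT : Convex ℝ T := convex_convexHull ℝ _
    have hv : ∀ z ∈ ({((0 : ℝ), (0 : ℝ)), (0, 1), (x₂, 1), (x₂, y₂), (x₃, y₃)} :
      Set (ℝ × ℝ)), z ∈ T := fun z hz => subset_convexHull ℝ _ hz
    -- Each point is placed on a vertical segment from the lower boundary up to the edge y = 1.
    have htop : (x, 1) ∈ T := by
      have h1 := Convex.mem_of_param hT (hv (0, 1) (by simp)) (hv (x₂, 1) (by simp))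
        (s := x / x₂) (by positivity) ((div_le_one hx₂0).2 hx1)
      convert h1 using 2
      · field_simp; ring
      · ring
    rcases le_total x x₃ with h | h
    · have h1 := Convex.mem_of_param hT (hv (0, 0) (by simp)) (hv (x₃, y₃) (by simp))
        (s := x / x₃) (by positivity) ((div_le_one hx₃0).2 h)
      have e1 : (1 - x / x₃) * 0 + x / x₃ * x₃ = x := by
        rw [div_mul_cancel₀ _ hx₃0.ne']; ring
      rw [e1] at h1
      refine Convex.mem_of_vertical hT h1 htop ?_ hy1
      have e2 : (1 - x / x₃) * 0 + x / x₃ * y₃ = x / (d - 1) := by rw [hxy₃]; field_simp; ring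
      rw [e2, div_le_iff₀ hd1]; linarith
    · have hs : (x - x₃) / (x₂ - x₃) * (x₂ - x₃) = x - x₃ := div_mul_cancel₀ _ (by linarith)
      have h1 := Convex.mem_of_param hT (hv (x₃, y₃) (by simp)) (hv (x₂, y₂) (by simp))
        (s := (x - x₃) / (x₂ - x₃)) (div_nonneg (by linarith) (by linarith))
        (by rw [div_le_one (by linarith)]; linarith)
      set s := (x - x₃) / (x₂ - x₃)
      have e1 : (1 - s) * x₃ + s * x₂ = x := by linarith
      rw [e1] at h1
      refine Convex.mem_of_vertical hT h1 htop ?_ hy1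
      have e2 : (d - 2) * (1 + ((1 - s) * y₃ + s * y₂)) = d * x := by
        rw [← e1]; linear_combination (-(1 - s)) * hxy₃' - s * hxy₂'
      by_contra hcon
      push Not at hcon
      nlinarith

end Pentagon

/-! ### From exponents to reciprocal exponents, and the theorem -/

lemma averagingEstimate_iff {F : Type*} [Field F] [Fintype F] {d : ℕ} {hd : 3 ≤ d} {p r : ℝ≥0∞}
    {K : ℝ} (hp : p ≠ 0) (hr : r ≠ 0) : AveragingEstimate F d hd p r K ↔
      ∀ f : (Fin d → F) → ℂ, meanNorm (r⁻¹).toReal (restrictedAverage F d hd f) ≤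
        K * meanNorm (p⁻¹).toReal f := by
  unfold AveragingEstimate
  simp_rw [normLp_eq_meanNorm hp, normLp_eq_meanNorm hr]

lemma toReal_inv_le_one {p : ℝ≥0∞} (hp : 1 ≤ p) : (p⁻¹).toReal ≤ 1 := by
  rw [← ENNReal.toReal_one]
  exact ENNReal.toReal_mono ENNReal.one_ne_top (ENNReal.inv_le_one.2 hp)

/-- The averaging estimate at every point of the pentagon. -/
lemma averagingEstimate_of_mem_convexHull {d : ℕ} (hd : 3 ≤ d) (hd4 : 4 ≤ d) {p r : ℝ≥0∞}
    (hp : p ≠ 0) (hr : r ≠ 0)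
    (h : ((p⁻¹).toReal, (r⁻¹).toReal) ∈ convexHull ℝ
          ({((0 : ℝ), (0 : ℝ)), (0, 1), (((d : ℝ) - 1) / d, 1),
            (((d : ℝ) - 1) / d, 1 / ((d : ℝ) - 2)),
            (((d : ℝ) ^ 2 - 3 * d + 2) / ((d : ℝ) ^ 2 - 2 * d + 2),
              ((d : ℝ) - 2) / ((d : ℝ) ^ 2 - 2 * d + 2))} : Set (ℝ × ℝ)))
    (F : Type*) [Field F] [Fintype F] (hF : Odd (Fintype.card F)) :
    AveragingEstimate F d hd p r 14 := by
  rw [mem_convexHull_pentagon_iff (by exact_mod_cast hd4)] at h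
  obtain ⟨h1, h2, -, h3, h4⟩ := h
  exact (averagingEstimate_iff hp hr).2 (meanNorm_restrictedAverage_le hd hd4 hF h1 h2 h3 h4)

end ConeAveraging

theorem theorem1p2 (d : ℕ) (hd : 4 ≤ d) (hd_even : Even d) :
    -- the estimate from `L^{d/(d-1)}` to `L^{d-2}`
    (6 ≤ d → ∃ K : ℝ, ∀ (F : Type u) [Field F] [Fintype F], Odd (Fintype.card F) →
      AveragingEstimate F d (by omega)
        (ENNReal.ofReal ((d : ℝ) / ((d : ℝ) - 1)))
        (ENNReal.ofReal ((d : ℝ) - 2)) K) ∧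
    -- the estimate from `L^{(d²-2d+2)/(d²-3d+2)}` to `L^{(d²-2d+2)/(d-2)}`
    (∃ K : ℝ, ∀ (F : Type u) [Field F] [Fintype F], Odd (Fintype.card F) →
      AveragingEstimate F d (by omega)
        (ENNReal.ofReal (((d : ℝ) ^ 2 - 2 * d + 2) / ((d : ℝ) ^ 2 - 3 * d + 2)))
        (ENNReal.ofReal (((d : ℝ) ^ 2 - 2 * d + 2) / ((d : ℝ) - 2))) K) ∧
    -- the sharp range over the fields for which the cone contains a `d/2`-dimensional subspace
    (6 ≤ d → ∀ p r : ℝ≥0∞, 1 ≤ p → 1 ≤ r →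
      ((∃ K : ℝ, ∀ (F : Type u) [Field F] [Fintype F], Odd (Fintype.card F) →
          ContainsHalfDimSubspace F d (by omega) → AveragingEstimate F d (by omega) p r K) ↔
        ((p⁻¹).toReal, (r⁻¹).toReal) ∈ convexHull ℝ
          ({((0 : ℝ), (0 : ℝ)), (0, 1), (((d : ℝ) - 1) / d, 1),
            (((d : ℝ) - 1) / d, 1 / ((d : ℝ) - 2)),
            (((d : ℝ) ^ 2 - 3 * d + 2) / ((d : ℝ) ^ 2 - 2 * d + 2),
              ((d : ℝ) - 2) / ((d : ℝ) ^ 2 - 2 * d + 2))} : Set (ℝ × ℝ)))) := by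
  have h4 : (4 : ℝ) ≤ d := by exact_mod_cast hd
  have h0 : (0 : ℝ) < d := by linarith
  have hd1 : (0 : ℝ) < (d : ℝ) - 1 := by linarith
  have hd2 : (0 : ℝ) < (d : ℝ) - 2 := by linarith
  have hD : (0 : ℝ) < (d : ℝ) ^ 2 - 2 * d + 2 := by nlinarith
  have hE : (0 : ℝ) < (d : ℝ) ^ 2 - 3 * d + 2 := by nlinarith
  refine ⟨fun _ => ⟨14, fun F _ _ hF => ?_⟩, ⟨14, fun F _ _ hF => ?_⟩, fun _ p r hp hr => ?_⟩
  · have a1 : 0 < (d : ℝ) / ((d : ℝ) - 1) := by positivity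
    refine averagingEstimate_of_mem_convexHull _ hd (ENNReal.ofReal_pos.2 a1).ne'
      (ENNReal.ofReal_pos.2 hd2).ne' (subset_convexHull ℝ _ ?_) F hF
    rw [ENNReal.toReal_inv, ENNReal.toReal_inv, ENNReal.toReal_ofReal a1.le,
      ENNReal.toReal_ofReal hd2.le, inv_div, ← one_div]
    simp
  · have a1 : 0 < ((d : ℝ) ^ 2 - 2 * d + 2) / ((d : ℝ) ^ 2 - 3 * d + 2) := by positivity
    have a2 : 0 < ((d : ℝ) ^ 2 - 2 * d + 2) / ((d : ℝ) - 2) := by positivity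
    refine averagingEstimate_of_mem_convexHull _ hd (ENNReal.ofReal_pos.2 a1).ne'
      (ENNReal.ofReal_pos.2 a2).ne' (subset_convexHull ℝ _ ?_) F hF
    rw [ENNReal.toReal_inv, ENNReal.toReal_inv, ENNReal.toReal_ofReal a1.le,
      ENNReal.toReal_ofReal a2.le, inv_div, inv_div]
    simp
  · have hp0 : p ≠ 0 := (zero_lt_one.trans_le hp).ne'
    have hr0 : r ≠ 0 := (zero_lt_one.trans_le hr).ne'
    constructor
    · rintro ⟨K, hK⟩
      rw [mem_convexHull_pentagon_iff h4]
      have hx0 : 0 ≤ (p⁻¹).toReal := ENNReal.toReal_nonneg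
      have hy0 : 0 ≤ (r⁻¹).toReal := ENNReal.toReal_nonneg
      have hx1 := toReal_inv_le_one hp
      have hy1 := toReal_inv_le_one hr
      set x := (p⁻¹).toReal
      set y := (r⁻¹).toReal
      -- The constant K serves all fields at once, so each of the three powers stays below 4K along
      -- an unbounded sequence of q.
      have key : ∀ n : ℕ, ∃ q : ℝ, n < q ∧ q ^ (d * x - (d - 1)) ≤ 4 * K ∧
          q ^ (x - (d - 1) * y) ≤ 4 * K ∧ q ^ (d / 2 * x - (d / 2 - 1) * (1 + y)) ≤ 4 * K := by
        intro n
        obtain ⟨F, _, _, hn, hF, hH⟩ :=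
          exists_field_containsHalfDimSubspace.{u} (by omega : 3 ≤ d) hd_even n
        exact ⟨Fintype.card F, by exact_mod_cast hn, necessary_powers hd hd_even hF hH hx0 hx1
          hy0 hy1 ((averagingEstimate_iff hp0 hr0).1 (hK F hF hH))⟩
      have k1 := exponent_nonpos_of_unbounded fun n =>
        let ⟨q, hn, h, _, _⟩ := key n; ⟨q, hn, h⟩
      have k2 := exponent_nonpos_of_unbounded fun n =>
        let ⟨q, hn, _, h, _⟩ := key n; ⟨q, hn, h⟩
      have k3 := exponent_nonpos_of_unbounded fun n =>
        let ⟨q, hn, _, _, h⟩ := key n; ⟨q, hn, h⟩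
      refine ⟨hx0, ?_, hy1, by linarith, by linarith⟩
      rw [le_div_iff₀ h0]; linarith
    · intro h
      exact ⟨14, fun F _ _ hF _ => averagingEstimate_of_mem_convexHull _ hd hp0 hr0 h F hF⟩
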